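/- Let $i\ge 2$ be an integer and $\alpha\in[0,\pi/2]$. Define the $i$-Fibonacci words over $\{0,1\}$ by $f_1=0$, $f_2=0^{i-1}1$ and $f_n=f_{n-1}f_{n-2}$ for $n\ge 3$. Let $\mathcal F_n\subset\mathbb R^2$ be the polygonal curve drawn from $f_n$ as follows: start at the origin with direction $\pi/2$; for $j=1,\dots,|f_n|$ draw a segment of length one in the current direction and then, if the $j$-th letter of $f_n$ is $0$, add $\alpha$ to the direction when $j$ is even and subtract $\alpha$ from it when $j$ is odd; if the letter is $1$, keep the direction. Let $w_n$ be the distance between the first and the last vertex of $\mathcal F_n$. Then, as $k\to\infty$, the scaled curves $\frac{\sqrt2}{w_n}\mathcal F_n$, taken along $n=6k+5$ if $i$ is even and along $n=6k+3$ if $i$ is odd, converge in the Hausdorff metric to a non-empty compact set $\mathcal F^{[i]}_\alpha$ (the Fibonacci word fractal), whose Hausdorff dimension is $$s=\frac{\ln(-2+\sqrt5)}{\ln R},\qquad R=\Bigl((1+\cos\alpha)+\sqrt{(1+\cos\alpha)^2+1}\Bigr)^{-1}.$$ The same is true, with the same value of $s$, if the words are numbered with every index raised by one (that is, $f_2=0$,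 $f_3=0^{i-1}1$), in other words if the limit is taken along $n=6k+4$ for even $i$ and along $n=6k+2$ for odd $i$ in the numbering above. -/

import Mathlib

noncomputable section

namespace FibonacciFractal

open Filter Topology

/-- The `i`-Fibonacci words over `{0, 1}`: `f₁ = 0`, `f₂ = 0^(i-1) 1`, `fₙ = fₙ₋₁ fₙ₋₂`.
The letters are written `false` for `0` and `true` for `1`.  The words are numbered from `1`;
the value at `0` is a placeholder. -/
def word (i : ℕ) : ℕ → List Bool
  | 0 => []
  | 1 => [false]
  | 2 => List.replicate (i - 1) false ++ [true]
  | n + 3 => word i (n + 2) ++ word i (n + 1)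

/-- The change of direction after the `j`-th segment (`j ≥ 1`) has been drawn, if the `j`-th letter
is `b`: none for the letter `1`; for the letter `0`, left (`+α`) if `j` is even and
right (`-α`) if `j` is odd. -/
def turn (α : ℝ) (j : ℕ) (b : Bool) : ℝ :=
  if b then 0 else if Even j then α else -α

/-- The direction after the first `m` letters of `w` have been processed; the initial direction
is `π / 2`.  The letter with list index `l` is the `(l + 1)`-st letter of the word. -/
def direction (α : ℝ) (w : List Bool) (m : ℕ) : ℝ :=
  Real.pi / 2 + ∑ l ∈ Finset.range m, turn α (l + 1) (w.getD l true)

/-- The vertex of the curve of `w` that is reached after `m` segments of length one,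
starting at the origin.  The plane `ℝ²` is identified with `ℂ`. -/
def vertex (α : ℝ) (w : List Bool) (m : ℕ) : ℂ :=
  ∑ l ∈ Finset.range m, Complex.exp ((direction α w l : ℂ) * Complex.I)

/-- The curve of a word, as a subset of the plane: the union of its unit segments,
one for each letter. -/
def curve (α : ℝ) (w : List Bool) : Set ℂ :=
  ⋃ m ∈ Finset.range w.length, segment ℝ (vertex α w m) (vertex α w (m + 1))

/-- The width of the curve of a word: the distance between its first and its last vertex. -/
def width (α : ℝ) (w : List Bool) : ℝ :=
  dist (vertex α w 0) (vertex α w w.length)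

/-- The `n`-th `i`-Fibonacci curve with drawing angle `α`, scaled to have width `√2`. -/
def scaledCurve (i : ℕ) (α : ℝ) (n : ℕ) : Set ℂ :=
  (fun z : ℂ => (Real.sqrt 2 / width α (word i n)) • z) '' curve α (word i n)

/-- `F` is the scaling limit, in the space of non-empty compact sets with the Hausdorff distance,
of the `i`-Fibonacci curves with indices `n 0, n 1, n 2, …`. -/
def IsScalingLimit (i : ℕ) (α : ℝ) (n : ℕ → ℕ) (F : Set ℂ) : Prop :=
  F.Nonempty ∧ IsCompact F ∧
    Tendsto (fun k => Metric.hausdorffEDist (scaledCurve i α (n k)) F) atTop (𝓝 0)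

/-- The indices along which the scaling limit is taken: `6k + 5` for even `i` and
`6k + 3` for odd `i`. -/
def index (i k : ℕ) : ℕ :=
  6 * k + if Even i then 5 else 3

/-- The scaling ratio `R`. -/
def scalingRatio (α : ℝ) : ℝ :=
  ((1 + Real.cos α) + Real.sqrt ((1 + Real.cos α) ^ 2 + 1))⁻¹

/-- The value `ln (√5 - 2) / ln R`. -/
def dimValue (α : ℝ) : ℝ :=
  Real.log (-2 + Real.sqrt 5) / Real.log (scalingRatio α)

end FibonacciFractal

end

/-! The sign of a turn depends on the parity of the position, so deleting the first letter of a word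
reflects the rest of its curve. Thus each letter acts by one fixed orientation-reversing motion, and
concatenation of words is composition of motions (`vertex_cons`, `path_append`). The linear parts of
these motions for the Fibonacci words, and the parities of the lengths, repeat with period three in
the index, up to complex conjugation (`IsSeed.levels`). A suitable initial frame `ρ` brings all `i`
of one parity, and in fact both parities, to the same normal form.

The self-similarity comes from the identity f(n+6) = f(n+3) f(n+3) f(n) (f(n+1) f(n+2)) (f(n+1)
f(n+2)) together with the fact that f(n+1) f(n+2) agrees with f(n+3) except in its last two letters.
So a curve consists of four copies, up to bounded errors, of the curve three indices before and one
copy of the curve six indices before. The displacements satisfy a real two-dimensional recursion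
with symmetric matrix of trace 2(1 + cos α) and determinant -1, up to a bounded perturbation; its
eigenvalues are 1/R and -R, so lengths grow by the factor 1/R per three indices (`exists_growth`).
Replacing the five displacements by their asymptotic values gives a system of five similarities with
ratios R, R, R², R, R. At level k the Hausdorff distance from the curve to the attractor magnified
by a multiple of R^(-k) grows at most linearly in k, because the parts are placed by isometries and
each step adds only a constant (`exists_hausdorffEDist_le`). After rescaling it tends to zero.

The limit is therefore similar to an attractor whose similarity dimension solves 4x + x² = 1 with x
= R^s, that is, x = √5 - 2. Words of even and of odd length lead to two different systems with the
same ratios; they account for the two numberings. The dimension equals the similarity dimension by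
the open set condition: covers by images of the attractor bound it above, and a Bernoulli measure
with a volume count bounds it below. The open set is a quadrilateral with sides adapted to the
directions exp(±iα/2), or a strip if α = 0. -/

/-! ### Self-similar sets: coding, upper bound for the dimension, Bernoulli measure. -/

noncomputable section

open Filter Topology MeasureTheory

/-- A finite system of surjective contracting similarities of the plane. -/
structure SimilaritySystem (m : ℕ) where
  map : Fin m → ℂ → ℂ
  ratio : Fin m → ℝ
  dist_map : ∀ j x y, dist (map j x) (map j y) = ratio j * dist x y
  surjective : ∀ j, Function.Surjective (map j)
  ratio_pos : ∀ j, 0 < ratio j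
  ratio_lt_one : ∀ j, ratio j < 1

namespace SimilaritySystem

variable {m : ℕ} (S : SimilaritySystem m)

/-- The composition of the maps named by a finite word. -/
def comp : List (Fin m) → ℂ → ℂ
  | [] => id
  | j :: w => S.map j ∘ comp w

/-- The product of the ratios named by a finite word. -/
def ratioOf (w : List (Fin m)) : ℝ := (w.map S.ratio).prod

/-- The initial word of length `n` of a sequence. -/
def initial (x : ℕ → Fin m) (n : ℕ) : List (Fin m) := (List.range n).map x

lemma initial_zero (x : ℕ → Fin m) : initial x 0 = [] := rfl

lemma initial_succ (x : ℕ → Fin m) (n : ℕ) : initial x (n + 1) = initial x n ++ [x n] := by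
  simp [initial, List.range_succ]

lemma initial_succ' (x : ℕ → Fin m) (n : ℕ) :
    initial x (n + 1) = x 0 :: initial (fun k => x (k + 1)) n := by
  simp [initial, List.range_succ_eq_map, Function.comp_def]

lemma length_initial (x : ℕ → Fin m) (n : ℕ) : (initial x n).length = n := by simp [initial]

lemma initial_take (x : ℕ → Fin m) {k n : ℕ} (h : k ≤ n) :
    (initial x n).take k = initial x k := by
  simp [initial, ← List.map_take, List.take_range, min_eq_left h]

lemma ratioOf_nil : S.ratioOf [] = 1 := rfl

lemma ratioOf_cons (j : Fin m) (w : List (Fin m)) :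
    S.ratioOf (j :: w) = S.ratio j * S.ratioOf w := by simp [ratioOf]

lemma ratioOf_append (v w : List (Fin m)) :
    S.ratioOf (v ++ w) = S.ratioOf v * S.ratioOf w := by simp [ratioOf]

lemma ratioOf_pos (w : List (Fin m)) : 0 < S.ratioOf w := by
  induction w with
  | nil => simp [ratioOf]
  | cons j w ih => rw [ratioOf_cons]; exact mul_pos (S.ratio_pos j) ih

lemma comp_append (v w : List (Fin m)) : S.comp (v ++ w) = S.comp v ∘ S.comp w := by
  induction v with
  | nil => rfl
  | cons j v ih => simp only [List.cons_append, comp, ih, Function.comp_assoc]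

lemma dist_comp (w : List (Fin m)) (x y : ℂ) :
    dist (S.comp w x) (S.comp w y) = S.ratioOf w * dist x y := by
  induction w with
  | nil => simp [comp, ratioOf]
  | cons j w ih => simp only [comp, Function.comp_apply, S.dist_map, ih, ratioOf_cons, mul_assoc]

lemma surjective_comp (w : List (Fin m)) : Function.Surjective (S.comp w) := by
  induction w with
  | nil => exact Function.surjective_id
  | cons j w ih => exact (S.surjective j).comp ih

lemma continuous_map (j : Fin m) : Continuous (S.map j) :=
  (LipschitzWith.of_dist_le_mul (K := ⟨S.ratio j, (S.ratio_pos j).le⟩)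
    fun x y => (S.dist_map j x y).le).continuous

lemma exists_ratio_le [NeZero m] : ∃ q : ℝ, 0 < q ∧ q < 1 ∧ ∀ j, S.ratio j ≤ q := by
  obtain ⟨j, hj⟩ := Finite.exists_max S.ratio
  exact ⟨S.ratio j, S.ratio_pos j, S.ratio_lt_one j, hj⟩

lemma exists_le_ratio [NeZero m] : ∃ q : ℝ, 0 < q ∧ q < 1 ∧ ∀ j, q ≤ S.ratio j := by
  obtain ⟨j, hj⟩ := Finite.exists_min S.ratio
  exact ⟨S.ratio j, S.ratio_pos j, S.ratio_lt_one j, hj⟩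

lemma ratioOf_le_pow {q : ℝ} (hq : ∀ j, S.ratio j ≤ q) (w : List (Fin m)) :
    S.ratioOf w ≤ q ^ w.length := by
  induction w with
  | nil => simp [ratioOf]
  | cons j w ih =>
    rw [ratioOf_cons, List.length_cons, pow_succ']
    exact mul_le_mul (hq j) ih (S.ratioOf_pos w).le ((S.ratio_pos j).le.trans (hq j))

/-- The image of the origin under the maps named by an initial word. -/
def approx (n : ℕ) (x : ℕ → Fin m) : ℂ := S.comp (initial x n) 0

/-- Two consecutive approximations are images, under one composition of n maps, of 0 and of one of
the finitely many points `S.map j 0`. The bound is uniform in the address, which gives both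
convergence and continuity of the coding map. -/
lemma exists_dist_approx_le [NeZero m] : ∃ q M : ℝ, 0 < q ∧ q < 1 ∧
    ∀ x n, dist (S.approx n x) (S.approx (n + 1) x) ≤ M * q ^ n := by
  obtain ⟨q, hq0, hq1, hq⟩ := S.exists_ratio_le
  obtain ⟨j, hj⟩ := Finite.exists_max fun j => dist 0 (S.map j 0)
  refine ⟨q, dist 0 (S.map j 0), hq0, hq1, fun x n => ?_⟩
  rw [approx, approx, initial_succ, comp_append, Function.comp_apply, dist_comp, mul_comm]
  refine mul_le_mul (hj (x n)) ?_ (S.ratioOf_pos _).le dist_nonneg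
  simpa [length_initial] using S.ratioOf_le_pow hq (initial x n)

/-- The point of the attractor with a given address. -/
def code (x : ℕ → Fin m) : ℂ := limUnder atTop fun n => S.approx n x

lemma tendsto_code [NeZero m] (x : ℕ → Fin m) :
    Tendsto (fun n => S.approx n x) atTop (𝓝 (S.code x)) := by
  obtain ⟨q, M, -, hq1, h⟩ := S.exists_dist_approx_le
  exact (cauchySeq_of_le_geometric q M hq1 (h x)).tendsto_limUnder

lemma continuous_approx (n : ℕ) : Continuous (S.approx n) := by
  induction n with
  | zero => exact continuous_const
  | succ n ih =>
    have h1 : Continuous fun p : Fin m × ℂ => S.map p.1 p.2 :=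
      continuous_prod_of_discrete_left.2 fun j => S.continuous_map j
    have h2 : Continuous fun x : ℕ → Fin m => (x 0, S.approx n fun k => x (k + 1)) := by
      refine (continuous_apply 0).prodMk (ih.comp ?_)
      exact continuous_pi fun k => continuous_apply (k + 1)
    refine (h1.comp h2).congr fun x => ?_
    simp [approx, initial_succ', comp]

lemma continuous_code [NeZero m] : Continuous S.code := by
  obtain ⟨q, M, hq0, hq1, h⟩ := S.exists_dist_approx_le
  have key : TendstoUniformly S.approx S.code atTop := by
    rw [Metric.tendstoUniformly_iff]
    intro ε hε
    have hlim : Tendsto (fun n : ℕ => M * q ^ n / (1 - q)) atTop (𝓝 0) := by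
      simpa using ((tendsto_pow_atTop_nhds_zero_of_lt_one hq0.le hq1).const_mul M).div_const (1 - q)
    filter_upwards [hlim.eventually_lt_const hε] with n hn x
    rw [dist_comm]
    exact (dist_le_of_le_geometric_of_tendsto q M hq1 (h x) (S.tendsto_code x) n).trans_lt hn
  exact key.continuous (Frequently.of_forall S.continuous_approx)

lemma code_cons [NeZero m] (x : ℕ → Fin m) :
    S.code x = S.map (x 0) (S.code fun k => x (k + 1)) := by
  refine tendsto_nhds_unique ((tendsto_add_atTop_iff_nat 1).2 (S.tendsto_code x)) ?_
  refine (((S.continuous_map (x 0)).tendsto _).comp (S.tendsto_code _)).congr fun n => ?_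
  simp [approx, initial_succ', comp]

lemma code_eq_comp [NeZero m] (n : ℕ) (x : ℕ → Fin m) :
    S.code x = S.comp (initial x n) (S.code fun k => x (k + n)) := by
  induction n generalizing x with
  | zero => rfl
  | succ n ih =>
    rw [code_cons, ih, initial_succ']
    simp only [comp, Function.comp_apply]
    congr 3

/-- The invariant set of the system. -/
def attractor : Set ℂ := Set.range S.code

lemma isCompact_attractor [NeZero m] : IsCompact S.attractor :=
  isCompact_range S.continuous_code

lemma attractor_nonempty [NeZero m] : S.attractor.Nonempty := Set.range_nonempty _

lemma attractor_eq [NeZero m] : S.attractor = ⋃ j, S.map j '' S.attractor := by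
  ext z
  simp only [attractor, Set.mem_iUnion, Set.mem_image, Set.mem_range, exists_exists_eq_and]
  constructor
  · rintro ⟨x, rfl⟩
    exact ⟨x 0, _, (S.code_cons x).symm⟩
  · rintro ⟨j, x, rfl⟩
    refine ⟨fun k => Nat.casesOn k j x, ?_⟩
    rw [code_cons]
    rfl

lemma ediam_comp_image (w : List (Fin m)) (A : Set ℂ) :
    Metric.ediam (S.comp w '' A) ≤ ENNReal.ofReal (S.ratioOf w) * Metric.ediam A := by
  refine Metric.ediam_le fun x hx y hy => ?_
  obtain ⟨a, ha, rfl⟩ := hx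
  obtain ⟨b, hb, rfl⟩ := hy
  rw [edist_dist, dist_comp, ENNReal.ofReal_mul (S.ratioOf_pos w).le, ← edist_dist]
  gcongr
  exact Metric.edist_le_ediam_of_mem ha hb

/-- The dimension of the invariant set is at most the similarity dimension. -/
theorem dimH_attractor_le [NeZero m] {s : ℝ} (hs : 0 < s) (hsum : ∑ j, S.ratio j ^ s = 1) :
    dimH S.attractor ≤ ENNReal.ofReal s := by
  obtain ⟨q, hq0, hq1, hq⟩ := S.exists_ratio_le
  set D := Metric.ediam S.attractor with hD
  have hDtop : D ≠ ⊤ := S.isCompact_attractor.isBounded.ediam_ne_top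
  -- Cover the attractor by its images under all words of length n; their diameters are at most q^n
  -- * D and tend to zero uniformly.
  have hbound : μH[s] S.attractor ≤ D ^ s := by
    have := Measure.hausdorffMeasure_le_liminf_sum (ι := fun n : ℕ => Fin n → Fin m) (l := atTop)
      s S.attractor (fun n => ENNReal.ofReal (q ^ n) * D) ?_
      (fun n w => S.comp (List.ofFn w) '' S.attractor) ?_ ?_
    · refine this.trans ?_
      refine liminf_le_of_le (by isBoundedDefault) fun b hb => ?_
      obtain ⟨n, hn⟩ := hb.exists
      refine hn.trans ?_
      calc ∑ w : Fin n → Fin m, Metric.ediam (S.comp (List.ofFn w) '' S.attractor) ^ s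
          ≤ ∑ w : Fin n → Fin m, ENNReal.ofReal (∏ i, S.ratio (w i) ^ s) * D ^ s := by
            refine Finset.sum_le_sum fun w _ => ?_
            refine (ENNReal.rpow_le_rpow (S.ediam_comp_image _ _) hs.le).trans_eq ?_
            rw [ENNReal.mul_rpow_of_nonneg _ _ hs.le,
              ENNReal.ofReal_rpow_of_pos (S.ratioOf_pos _)]
            congr 2
            rw [ratioOf, List.map_ofFn, List.prod_ofFn]
            exact (Real.finsetProd_rpow _ (fun i => S.ratio (w i))
              (fun i _ => (S.ratio_pos _).le) s).symm
        -- The sum over words of the products of weights is the n-th power of the sum of the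
        -- weights, hence 1.
        _ = D ^ s := by
            rw [← Finset.sum_mul, ← ENNReal.ofReal_sum_of_nonneg, ← Fintype.sum_pow (fun j => S.ratio j ^ s) n, hsum]
            · simp
            · exact fun w _ => Finset.prod_nonneg fun i _ => Real.rpow_nonneg (S.ratio_pos _).le _
    · have h1 : Tendsto (fun n : ℕ => ENNReal.ofReal (q ^ n)) atTop (𝓝 0) := by
        simpa using ENNReal.tendsto_ofReal (tendsto_pow_atTop_nhds_zero_of_lt_one hq0.le hq1)
      simpa using ENNReal.Tendsto.mul_const h1 (Or.inr hDtop)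
    · refine Eventually.of_forall fun n w => (S.ediam_comp_image _ _).trans ?_
      gcongr
      simpa using S.ratioOf_le_pow hq (List.ofFn w)
    · refine Eventually.of_forall fun n => ?_
      rintro _ ⟨x, rfl⟩
      refine Set.mem_iUnion.2 ⟨fun i => x i, _, Set.mem_range_self fun k => x (k + n), ?_⟩
      rw [S.code_eq_comp n x]
      congr 1
      simp [initial, List.ofFn_eq_map, ← List.map_coe_finRange_eq_range]
  have := dimH_le_of_hausdorffMeasure_ne_top (s := S.attractor) (d := s.toNNReal) (by
    rw [Real.coe_toNNReal _ hs.le]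
    exact ne_top_of_le_ne_top (ENNReal.rpow_ne_top_of_nonneg hs.le hDtop) hbound)
  exact this

/-- Incomparable words have a first place where they differ; behind the common prefix, which acts
injectively, the images lie in the images of `U` under two different maps. -/
lemma disjoint_comp_image {U : Set ℂ} (hU : ∀ j, S.map j '' U ⊆ U)
    (hdis : Pairwise fun j k => Disjoint (S.map j '' U) (S.map k '' U)) :
    ∀ v w : List (Fin m), ¬ v <+: w → ¬ w <+: v →
      Disjoint (S.comp v '' U) (S.comp w '' U) := by
  have hsub : ∀ w : List (Fin m), S.comp w '' U ⊆ U := by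
    intro w
    induction w with
    | nil => simp [comp]
    | cons j w ih =>
      simp only [comp, Set.image_comp]
      exact (Set.image_mono ih).trans (hU j)
  have hinj : ∀ j, Function.Injective (S.map j) := fun j x y h => by
    have := S.dist_map j x y
    rw [h, dist_self, eq_comm, mul_eq_zero] at this
    exact dist_eq_zero.1 (this.resolve_left (S.ratio_pos j).ne')
  intro v
  induction v with
  | nil => intro w h; exact absurd List.nil_prefix h
  | cons j v ih =>
    intro w h1 h2
    cases w with
    | nil => exact absurd List.nil_prefix h2
    | cons k w =>
      simp only [comp, Set.image_comp]
      by_cases hjk : j = k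
      · subst hjk
        rw [List.prefix_cons_inj] at h1 h2
        exact (Set.disjoint_image_iff (hinj j)).2 (ih w h1 h2)
      · exact (hdis hjk).mono (Set.image_mono (hsub v)) (Set.image_mono (hsub w))

/-- The stopping times of a system at a given scale. -/
lemma exists_stopping [NeZero m] {ρ q : ℝ} (hρ : 0 < ρ) (hρ1 : ρ ≤ 1) (hq0 : 0 < q) (hq1 : q < 1)
    (hq : ∀ j, q ≤ S.ratio j) (x : ℕ → Fin m) :
    ∃ n, S.ratioOf (initial x n) ≤ ρ ∧ q * ρ ≤ S.ratioOf (initial x n) ∧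
      ∀ k, S.ratioOf (initial x k) ≤ ρ → n ≤ k := by
  classical
  obtain ⟨q', hq0', hq1', hq'⟩ := S.exists_ratio_le
  have hex : ∃ n, S.ratioOf (initial x n) ≤ ρ := by
    obtain ⟨n, hn⟩ := exists_pow_lt_of_lt_one hρ hq1'
    refine ⟨n, (S.ratioOf_le_pow hq' _).trans ?_⟩
    rw [length_initial]
    exact hn.le
  refine ⟨Nat.find hex, Nat.find_spec hex, ?_, fun k hk => Nat.find_min' hex hk⟩
  rcases hn : Nat.find hex with _ | n
  · rw [initial_zero, ratioOf_nil]
    nlinarith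
  -- One letter earlier the ratio still exceeds `ρ`, and the last letter costs at most the factor
  -- `q`.
  · have h : ρ < S.ratioOf (initial x n) := not_le.1 (Nat.find_min hex (by omega))
    rw [initial_succ, ratioOf_append, mul_comm]
    refine mul_le_mul h.le ?_ hq0.le (S.ratioOf_pos _).le
    simpa [ratioOf] using hq (x n)

section Bernoulli

variable {s : ℝ}

/-- The probability weights given by the powers of the ratios. -/
def weights (hsum : ∑ j, S.ratio j ^ s = 1) : PMF (Fin m) :=
  PMF.ofFintype (fun j => ENNReal.ofReal (S.ratio j ^ s)) (by
    rw [← ENNReal.ofReal_sum_of_nonneg fun j _ => Real.rpow_nonneg (S.ratio_pos j).le s, hsum,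
      ENNReal.ofReal_one])

/-- The Bernoulli measure on the space of addresses. -/
def bernoulli (hsum : ∑ j, S.ratio j ^ s = 1) : Measure (ℕ → Fin m) :=
  Measure.infinitePi fun _ => (S.weights hsum).toMeasure

instance (hsum : ∑ j, S.ratio j ^ s = 1) : IsProbabilityMeasure (S.bernoulli hsum) := by
  unfold bernoulli; infer_instance

/-- A cylinder fixes finitely many coordinates, so its measure is the product of their weights. This
ties the mass of a piece of the attractor to the s-th power of its size. -/
lemma bernoulli_cylinder (hsum : ∑ j, S.ratio j ^ s = 1) (x : ℕ → Fin m) (n : ℕ) :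
    S.bernoulli hsum {y | initial y n = initial x n} =
      ENNReal.ofReal (S.ratioOf (initial x n) ^ s) := by
  have hset : {y | initial y n = initial x n} =
      ((Finset.range n : Finset ℕ) : Set ℕ).pi fun i => {x i} := by
    ext y
    simp [initial, Set.mem_pi]
  rw [hset, bernoulli, Measure.infinitePi_pi _ fun i _ => measurableSet_singleton _]
  have : ∀ i, (S.weights hsum).toMeasure {x i} = ENNReal.ofReal (S.ratio (x i) ^ s) := fun i => by
    rw [PMF.toMeasure_apply_singleton _ _ (measurableSet_singleton _)]
    rfl
  simp only [this]
  rw [← ENNReal.ofReal_prod_of_nonneg fun i _ => Real.rpow_nonneg (S.ratio_pos _).le _]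
  congr 1
  rw [Real.finsetProd_rpow _ _ fun i _ => (S.ratio_pos _).le]
  congr 1
  simp only [ratioOf, initial, Finset.prod_eq_multiset_prod, List.map_map]
  rfl

end Bernoulli

end SimilaritySystem

end

/-! ### Lower bound for the dimension under the open set condition. -/

noncomputable section

open Filter Topology MeasureTheory

namespace SimilaritySystem

variable {m : ℕ} (S : SimilaritySystem m)

/-- Under the open set condition, the Bernoulli measure of the addresses of the points in a set of
diameter at most `ρ` is at most a constant multiple of `ρ ^ s`. -/
lemma exists_bernoulli_preimage_le [NeZero m] {s : ℝ} (hs : 0 < s)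
    (hsum : ∑ j, S.ratio j ^ s = 1)
    {U : Set ℂ} (hUo : IsOpen U) (hUne : U.Nonempty) (hU : ∀ j, S.map j '' U ⊆ U)
    (hdis : Pairwise fun j k => Disjoint (S.map j '' U) (S.map k '' U)) :
    ∃ K : ℝ, 0 < K ∧ ∀ (B : Set ℂ) (ρ : ℝ), 0 < ρ → ρ ≤ 1 → Metric.ediam B ≤ ENNReal.ofReal ρ →
      S.bernoulli hsum (S.code ⁻¹' B) ≤ ENNReal.ofReal (K * ρ ^ s) := by
  obtain ⟨q, hq0, hq1, hq⟩ := S.exists_le_ratio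
  obtain ⟨x₀, hx₀⟩ := hUne
  obtain ⟨a, ha, hball⟩ := Metric.isOpen_iff.1 hUo x₀ hx₀
  obtain ⟨D, hD⟩ := S.isCompact_attractor.isBounded.subset_closedBall x₀
  have hD0 : 0 ≤ D := by
    obtain ⟨y, hy⟩ := S.attractor_nonempty
    exact dist_nonneg.trans (hD hy)
  -- The constant is a ratio of areas: disjoint discs of radius at least q * ρ * a inside one disc
  -- of radius (1 + D + a) * ρ.
  refine ⟨((1 + D + a) / (a * q)) ^ 2, by positivity, fun B ρ hρ hρ1 hB => ?_⟩
  choose n hn1 hn2 hn3 using S.exists_stopping hρ hρ1 hq0 hq1 hq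
  rcases (S.code ⁻¹' B).eq_empty_or_nonempty with he | ⟨x₁, hx₁⟩
  · rw [he]; simp
  -- The stopping words of the addresses of points of `B`. Each has ratio between q * ρ and `ρ`, so
  -- it remains to bound their number.
  set T : Set (List (Fin m)) := (fun x => initial x (n x)) '' (S.code ⁻¹' B) with hT
  have hTc : T.Countable := Set.to_countable T
  have hcover : S.code ⁻¹' B ⊆ ⋃ w ∈ T, {y | initial y w.length = w} := fun x hx =>
    Set.mem_biUnion (Set.mem_image_of_mem _ hx) (by simp [length_initial])
  have hmeas : S.bernoulli hsum (S.code ⁻¹' B) ≤ ∑' w : T, ENNReal.ofReal (ρ ^ s) := by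
    refine (measure_mono hcover).trans ((measure_biUnion_le _ hTc _).trans ?_)
    refine ENNReal.tsum_le_tsum ?_
    rintro ⟨w, x, hx, rfl⟩
    simp only [length_initial]
    rw [bernoulli_cylinder]
    exact ENNReal.ofReal_le_ofReal (Real.rpow_le_rpow (S.ratioOf_pos _).le (hn1 x) hs.le)
  have himage : ∀ w, S.comp w '' Metric.ball x₀ a =
      Metric.ball (S.comp w x₀) (S.ratioOf w * a) := by
    intro w
    ext z
    obtain ⟨y, rfl⟩ := S.surjective_comp w z
    rw [Metric.mem_ball, dist_comp, mul_lt_mul_iff_right₀ (S.ratioOf_pos w), Set.mem_image]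
    constructor
    · rintro ⟨y', hy', he⟩
      have := S.dist_comp w y' y
      rw [he, dist_self, eq_comm, mul_eq_zero] at this
      rw [← dist_eq_zero.1 (this.resolve_left (S.ratioOf_pos w).ne')]
      exact hy'
    · exact fun h => ⟨y, h, rfl⟩
  have hdisj : T.PairwiseDisjoint fun w => Metric.ball (S.comp w x₀) (S.ratioOf w * a) := by
    -- By minimality of the stopping time, no stopping word is a proper prefix of another.
    have key : ∀ x y, initial x (n x) <+: initial y (n y) →
        initial x (n x) = initial y (n y) := by
      intro x y h
      have hle : n x ≤ n y := by simpa [length_initial] using h.length_le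
      have hxy : initial x (n x) = initial y (n x) := by
        rw [List.prefix_iff_eq_take.1 h, length_initial, initial_take _ hle]
      have := hn3 y (n x) (by rw [← hxy]; exact hn1 x)
      rw [hxy, le_antisymm hle this]
    rintro _ ⟨x, -, rfl⟩ _ ⟨y, -, rfl⟩ hne
    simp only [Function.onFun, ← himage]
    exact (S.disjoint_comp_image hU hdis _ _ (fun h => hne (key x y h))
      (fun h => hne (key y x h).symm)).mono (Set.image_mono hball) (Set.image_mono hball)
  -- The radius adds up the three distances ρ * a from a point to the centre of its disc, ρ * D from
  -- there to a coded point, and `ρ` within `B`.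
  have hvol : ∑' w : T, volume (Metric.ball (S.comp w x₀) (S.ratioOf w * a)) ≤
      volume (Metric.ball (S.code x₁) ((1 + D + a) * ρ)) := by
    rw [← measure_biUnion hTc hdisj fun w _ => measurableSet_ball]
    refine measure_mono (Set.iUnion₂_subset ?_)
    rintro _ ⟨x, hx, rfl⟩ z hz
    rw [Metric.mem_ball] at hz ⊢
    have h1 : dist (S.comp (initial x (n x)) x₀) (S.code x) ≤ ρ * D := by
      rw [S.code_eq_comp (n x) x, dist_comp, dist_comm x₀]
      exact mul_le_mul (hn1 x) (hD (Set.mem_range_self _)) dist_nonneg hρ.le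
    have h2 : dist (S.code x) (S.code x₁) ≤ ρ := by
      have := (Metric.edist_le_ediam_of_mem (show S.code x ∈ B from hx)
        (show S.code x₁ ∈ B from hx₁)).trans hB
      rwa [edist_dist, ENNReal.ofReal_le_ofReal_iff hρ.le] at this
    have h3 := mul_le_mul_of_nonneg_right (hn1 x) ha.le
    have h4 := dist_triangle4 z (S.comp (initial x (n x)) x₀) (S.code x) (S.code x₁)
    nlinarith
  have hcount : (∑' _ : T, (1 : ENNReal)) * ENNReal.ofReal (q * ρ * a) ^ 2 ≤
      ENNReal.ofReal ((1 + D + a) * ρ) ^ 2 := by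
    have h1 : ∑' _ : T, ENNReal.ofReal (q * ρ * a) ^ 2 * (NNReal.pi : ENNReal) ≤
        ENNReal.ofReal ((1 + D + a) * ρ) ^ 2 * NNReal.pi := by
      rw [← Complex.volume_ball (S.code x₁) ((1 + D + a) * ρ)]
      refine le_trans (ENNReal.tsum_le_tsum ?_) hvol
      rintro ⟨_, x, hx, rfl⟩
      rw [Complex.volume_ball]
      gcongr
      exact hn2 x
    rw [ENNReal.tsum_mul_right] at h1
    have hpi0 : (NNReal.pi : ENNReal) ≠ 0 := by simpa using NNReal.pi_ne_zero
    have := (ENNReal.mul_le_mul_iff_left hpi0 ENNReal.coe_ne_top).1 h1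
    rwa [← ENNReal.tsum_mul_right, one_mul]
  have hcount' : (∑' _ : T, (1 : ENNReal)) ≤ ENNReal.ofReal (((1 + D + a) / (a * q)) ^ 2) := by
    have hp : 0 < q * ρ * a := by positivity
    have h0 : ENNReal.ofReal (q * ρ * a) ^ 2 ≠ 0 := by
      simpa using hp
    have h1 : ENNReal.ofReal (q * ρ * a) ^ 2 ≠ ⊤ := ENNReal.pow_ne_top ENNReal.ofReal_ne_top
    refine (ENNReal.mul_le_mul_iff_left h0 h1).1 (hcount.trans_eq ?_)
    rw [← ENNReal.ofReal_pow (by positivity), ← ENNReal.ofReal_pow hp.le,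
      ← ENNReal.ofReal_mul (by positivity)]
    congr 1
    field_simp
  calc S.bernoulli hsum (S.code ⁻¹' B) ≤ ∑' w : T, ENNReal.ofReal (ρ ^ s) := hmeas
    _ = (∑' _ : T, (1 : ENNReal)) * ENNReal.ofReal (ρ ^ s) := by
      rw [← ENNReal.tsum_mul_right, one_mul]
    _ ≤ ENNReal.ofReal (((1 + D + a) / (a * q)) ^ 2) * ENNReal.ofReal (ρ ^ s) := by gcongr
    _ = _ := (ENNReal.ofReal_mul (by positivity)).symm

/-- Under the open set condition, the dimension of the invariant set is at least the similarity
dimension. -/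
theorem le_dimH_attractor [NeZero m] {s : ℝ} (hs : 0 < s) (hsum : ∑ j, S.ratio j ^ s = 1)
    {U : Set ℂ} (hUo : IsOpen U) (hUne : U.Nonempty) (hU : ∀ j, S.map j '' U ⊆ U)
    (hdis : Pairwise fun j k => Disjoint (S.map j '' U) (S.map k '' U)) :
    ENNReal.ofReal s ≤ dimH S.attractor := by
  obtain ⟨K, hK, hle⟩ := S.exists_bernoulli_preimage_le hs hsum hUo hUne hU hdis
  have hcm : Measurable S.code := S.continuous_code.measurable
  set μ := (S.bernoulli hsum).map S.code with hμ
  have hμB : ∀ B : Set ℂ, Metric.ediam B ≤ 1 →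
      μ B ≤ ENNReal.ofReal K * Metric.ediam B ^ s := by
    intro B hB
    have hBtop : Metric.ediam B ≠ ⊤ := ne_top_of_le_ne_top ENNReal.one_ne_top hB
    have hr1 : (Metric.ediam B).toReal ≤ 1 := by
      simpa using ENNReal.toReal_mono ENNReal.one_ne_top hB
    -- The closure is measurable and has the same diameter, so arbitrary sets `B` are allowed.
    have hcl : μ B ≤ S.bernoulli hsum (S.code ⁻¹' closure B) :=
      (measure_mono subset_closure).trans_eq (Measure.map_apply hcm isClosed_closure.measurableSet)
    refine hcl.trans ?_
    rcases eq_or_ne (Metric.ediam B) 0 with h0 | h0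
    · rw [h0, ENNReal.zero_rpow_of_pos hs, mul_zero]
      -- The estimate needs a positive scale; for diameter zero, let the scale tend to zero.
      have hlim : Tendsto (fun ρ : ℝ => ENNReal.ofReal (K * ρ ^ s)) (𝓝[>] 0) (𝓝 0) := by
        have h1 : Tendsto (fun ρ : ℝ => K * ρ ^ s) (𝓝 0) (𝓝 0) := by
          have := (Real.continuousAt_rpow_const 0 s (Or.inr hs.le)).tendsto.const_mul K
          simpa [Real.zero_rpow hs.ne'] using this
        simpa using (ENNReal.tendsto_ofReal h1).mono_left nhdsWithin_le_nhds
      refine ge_of_tendsto hlim ?_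
      filter_upwards [Ioc_mem_nhdsGT one_pos] with ρ hρ
      exact hle _ ρ hρ.1 hρ.2 (by rw [Metric.ediam_closure, h0]; exact zero_le)
    · have hpos : 0 < (Metric.ediam B).toReal := ENNReal.toReal_pos h0 hBtop
      refine (hle _ _ hpos hr1 (by rw [Metric.ediam_closure, ENNReal.ofReal_toReal hBtop])).trans_eq
        ?_
      rw [ENNReal.ofReal_mul hK.le, ← ENNReal.ofReal_rpow_of_pos hpos, ENNReal.ofReal_toReal hBtop]
  have hK0 : ENNReal.ofReal K ≠ 0 := by simpa using hK
  have hmain : (ENNReal.ofReal K)⁻¹ • μ ≤ μH[s] := by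
    refine Measure.le_hausdorffMeasure s _ 1 one_pos fun B hB => ?_
    rw [Measure.smul_apply, smul_eq_mul, mul_comm, ← div_eq_mul_inv]
    exact ENNReal.div_le_of_le_mul' (hμB B hB)
  have hpos : μH[s] S.attractor ≠ 0 := by
    have h1 : μ S.attractor = 1 := by
      rw [hμ, Measure.map_apply hcm S.isCompact_attractor.measurableSet, attractor,
        Set.preimage_range, measure_univ]
    have h2 := hmain S.attractor
    rw [Measure.smul_apply, h1, smul_eq_mul, mul_one] at h2
    intro h
    rw [h, nonpos_iff_eq_zero, ENNReal.inv_eq_zero] at h2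
    exact ENNReal.ofReal_ne_top h2
  have := le_dimH_of_hausdorffMeasure_ne_zero (s := S.attractor) (d := s.toNNReal)
    (by rwa [Real.coe_toNNReal _ hs.le])
  exact this

end SimilaritySystem

end

/-! ### The two systems of five similarities and their common ratios. -/

noncomputable section

open Filter Topology

namespace FibonacciFractal

/-- Complex conjugation, iterated `k` times. -/
def cj (k : ℕ) : ℂ →+* ℂ := if Even k then RingHom.id ℂ else starRingEnd ℂ

lemma cj_of_even {k : ℕ} (h : Even k) (z : ℂ) : cj k z = z := by simp [cj, h]

lemma cj_of_odd {k : ℕ} (h : Odd k) (z : ℂ) : cj k z = starRingEnd ℂ z := by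
  simp [cj, Nat.not_even_iff_odd.2 h]

@[simp] lemma cj_zero (z : ℂ) : cj 0 z = z := cj_of_even (by simp) z

@[simp] lemma cj_one (z : ℂ) : cj 1 z = starRingEnd ℂ z := cj_of_odd (by simp) z

lemma cj_add (a b : ℕ) (z : ℂ) : cj (a + b) z = cj a (cj b z) := by
  rcases Nat.even_or_odd a with ha | ha <;> rcases Nat.even_or_odd b with hb | hb
  · rw [cj_of_even ha, cj_of_even hb, cj_of_even (ha.add hb)]
  · rw [cj_of_even ha, cj_of_odd hb, cj_of_odd (ha.add_odd hb)]
  · rw [cj_of_odd ha, cj_of_even hb, cj_of_odd (ha.add_even hb)]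
  · rw [cj_of_odd ha, cj_of_odd hb, cj_of_even (ha.add_odd hb), Complex.conj_conj]

@[simp] lemma cj_ofReal (k : ℕ) (x : ℝ) : cj k (x : ℂ) = x := by
  rcases Nat.even_or_odd k with h | h
  · rw [cj_of_even h]
  · rw [cj_of_odd h, Complex.conj_ofReal]

@[simp] lemma norm_cj (k : ℕ) (z : ℂ) : ‖cj k z‖ = ‖z‖ := by
  rcases Nat.even_or_odd k with h | h
  · rw [cj_of_even h]
  · rw [cj_of_odd h, RCLike.norm_conj]

lemma cj_cj (k : ℕ) (z : ℂ) : cj k (cj k z) = z := by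
  rw [← cj_add, cj_of_even (by simp)]

lemma isometry_cj (k : ℕ) : Isometry (cj k) :=
  Isometry.of_dist_eq fun x y => by rw [dist_eq_norm, dist_eq_norm, ← map_sub, norm_cj]

/-- The system of the similarities `z ↦ r j * e j * cj (flip j) z + t j` with `‖e j‖ = 1`. -/
def affineSystem {m : ℕ} (r : Fin m → ℝ) (e t : Fin m → ℂ) (flip : Fin m → ℕ)
    (hr : ∀ j, 0 < r j ∧ r j < 1) (he : ∀ j, ‖e j‖ = 1) : SimilaritySystem m where
  map j z := r j * e j * cj (flip j) z + t j
  ratio := r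
  dist_map j x y := by
    rw [dist_eq_norm, add_sub_add_right_eq_sub, ← mul_sub, ← map_sub, norm_mul, norm_mul, norm_cj,
      he, mul_one, Complex.norm_of_nonneg (hr j).1.le, dist_eq_norm]
  surjective j z := by
    have h0 : (r j : ℂ) * e j ≠ 0 := by
      refine mul_ne_zero (Complex.ofReal_ne_zero.2 (hr j).1.ne') ?_
      rw [← norm_ne_zero_iff, he]
      exact one_ne_zero
    refine ⟨cj (flip j) ((z - t j) / (r j * e j)), ?_⟩
    change (r j : ℂ) * e j * cj (flip j) (cj (flip j) ((z - t j) / (r j * e j))) + t j = z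
    rw [cj_cj, mul_div_cancel₀ _ h0, sub_add_cancel]
  ratio_pos j := (hr j).1
  ratio_lt_one j := (hr j).2

section Constants

variable {α : ℝ}

lemma scalingRatio_pos (hc : 0 ≤ Real.cos α) : 0 < scalingRatio α := by
  unfold scalingRatio
  positivity

/-- The definition of R is the reciprocal of a root of λ² - 2(1 + cos α)λ - 1, the characteristic
polynomial of the displacement recursion. Only this equation and positivity of R are used later for
its algebra. -/
lemma scalingRatio_sq (hc : 0 ≤ Real.cos α) :
    scalingRatio α ^ 2 + 2 * (1 + Real.cos α) * scalingRatio α = 1 := by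
  have h1 := Real.sq_sqrt (show 0 ≤ (1 + Real.cos α) ^ 2 + 1 by positivity)
  have h2 : 0 < (1 + Real.cos α) + Real.sqrt ((1 + Real.cos α) ^ 2 + 1) := by positivity
  unfold scalingRatio
  field_simp
  linear_combination -h1

lemma scalingRatio_lt (hc : 0 ≤ Real.cos α) : 2 * scalingRatio α < 1 := by
  have h1 := scalingRatio_pos hc
  have h2 := scalingRatio_sq hc
  nlinarith [mul_nonneg hc h1.le, pow_pos h1 2]

/-- The unit complex number with argument `α / 2`. -/
def halfTurn (α : ℝ) : ℂ := Complex.exp ((α / 2 : ℝ) * Complex.I)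

lemma norm_halfTurn (α : ℝ) : ‖halfTurn α‖ = 1 := Complex.norm_exp_ofReal_mul_I _

lemma halfTurn_re (α : ℝ) : (halfTurn α).re = Real.cos (α / 2) :=
  Complex.exp_ofReal_mul_I_re _

lemma halfTurn_im (α : ℝ) : (halfTurn α).im = Real.sin (α / 2) :=
  Complex.exp_ofReal_mul_I_im _

lemma halfTurn_mul_conj (α : ℝ) : halfTurn α * starRingEnd ℂ (halfTurn α) = 1 := by
  rw [Complex.mul_conj, Complex.normSq_eq_norm_sq, norm_halfTurn]
  simp

lemma halfTurn_sq_add (α : ℝ) :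
    halfTurn α ^ 2 + starRingEnd ℂ (halfTurn α) ^ 2 = 2 * (Real.cos α : ℂ) := by
  have h1 : halfTurn α ^ 2 = Complex.exp (α * Complex.I) := by
    rw [halfTurn, ← Complex.exp_nat_mul]
    congr 1
    push_cast
    ring
  rw [← map_pow, h1, Complex.add_conj, Complex.exp_ofReal_mul_I_re]
  push_cast
  ring

/-- The contraction ratios of the five parts of the fractal. -/
def partRatio (α : ℝ) : Fin 5 → ℝ :=
  ![scalingRatio α, scalingRatio α, scalingRatio α ^ 2, scalingRatio α, scalingRatio α]

lemma partRatio_mem (hc : 0 ≤ Real.cos α) (j : Fin 5) : 0 < partRatio α j ∧ partRatio α j < 1 := by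
  have h1 := scalingRatio_pos hc
  have h2 := scalingRatio_lt hc
  have h3 : 0 < scalingRatio α ∧ scalingRatio α < 1 := ⟨h1, by linarith⟩
  have h4 : 0 < scalingRatio α ^ 2 ∧ scalingRatio α ^ 2 < 1 := by constructor <;> nlinarith
  fin_cases j
  exacts [h3, h3, h4, h3, h3]

lemma dimValue_pos (hc : 0 ≤ Real.cos α) : 0 < dimValue α := by
  have h1 := scalingRatio_pos hc
  have h2 := scalingRatio_lt hc
  have h3 := Real.sq_sqrt (show (0 : ℝ) ≤ 5 by norm_num)
  have h4 := Real.sqrt_nonneg 5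
  refine div_pos_of_neg_of_neg (Real.log_neg ?_ ?_) (Real.log_neg h1 (by linarith)) <;> nlinarith

/-- The exponent is chosen so that R^s = √5 - 2, the positive root of x² + 4x = 1. -/
lemma sum_partRatio_rpow (hc : 0 ≤ Real.cos α) : ∑ j, partRatio α j ^ dimValue α = 1 := by
  have h1 := scalingRatio_pos hc
  have h2 := scalingRatio_lt hc
  have h3 := Real.sq_sqrt (show (0 : ℝ) ≤ 5 by norm_num)
  have h4 := Real.sqrt_nonneg 5
  have hlog : Real.log (scalingRatio α) ≠ 0 := (Real.log_neg h1 (by linarith)).ne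
  have key : scalingRatio α ^ dimValue α = -2 + Real.sqrt 5 := by
    rw [Real.rpow_def_of_pos h1, dimValue, mul_div_cancel₀ _ hlog, Real.exp_log (by nlinarith)]
  have key2 : (scalingRatio α ^ 2) ^ dimValue α = (-2 + Real.sqrt 5) ^ 2 := by
    rw [← key, ← Real.rpow_natCast, ← Real.rpow_mul h1.le, mul_comm, Real.rpow_mul h1.le,
      Real.rpow_natCast]
  simp only [partRatio, Fin.sum_univ_five, Matrix.cons_val]
  rw [key, key2]
  linear_combination h3

end Constants

/-- The position of the endpoint of the fractal given by the words of even length, in the frame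
in which the words of odd length have displacement close to `1` and `exp (-α I / 2)`. -/
def evenEnd (α : ℝ) : ℂ := starRingEnd ℂ (halfTurn α) + scalingRatio α * halfTurn α

/-- The rotations of the five parts of the fractal given by the words of even length. -/
def evenRot (α : ℝ) : Fin 5 → ℂ :=
  ![1, starRingEnd ℂ (halfTurn α) ^ 2, starRingEnd ℂ (halfTurn α) ^ 4,
    starRingEnd ℂ (halfTurn α) ^ 2, 1]

/-- A part taken one level higher appears conjugated once more. Adding that level to the entry gives
the parity of the number of preceding letters, which is always even here because all five parts have
even length. -/
def evenFlip : Fin 5 → ℕ := ![1, 1, 0, 1, 1]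

/-- The displacement of the end of a part, before translation. -/
def partEnd (r : Fin 5 → ℝ) (e : Fin 5 → ℂ) (flip : Fin 5 → ℕ) (P : ℂ) (j : Fin 5) : ℂ :=
  r j * e j * cj (flip j) P

/-- The initial points of five consecutive parts, given their displacements. -/
def partialSums (d : Fin 5 → ℂ) : Fin 5 → ℂ :=
  ![0, d 0, d 0 + d 1, d 0 + d 1 + d 2, d 0 + d 1 + d 2 + d 3]

/-- The rotations of the five parts of the fractal given by the words of odd length. -/
def oddRot (α : ℝ) : Fin 5 → ℂ := ![1, 1, 1, 1, starRingEnd ℂ (halfTurn α) ^ 4]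

/-- Corrected by the levels 1, 1, 0, 1, 1 of the parts, the parities alternate, since all five parts
have odd length. -/
def oddFlip : Fin 5 → ℕ := ![1, 0, 0, 0, 1]

lemma norm_evenRot (α : ℝ) (j : Fin 5) : ‖evenRot α j‖ = 1 := by
  fin_cases j <;> simp [evenRot, norm_halfTurn]

lemma norm_oddRot (α : ℝ) (j : Fin 5) : ‖oddRot α j‖ = 1 := by
  fin_cases j <;> simp [oddRot, norm_halfTurn]

/-- The system of consecutive parts with given ratios, rotations and reflections. -/
def chainSystem {α : ℝ} (hc : 0 ≤ Real.cos α) (e : Fin 5 → ℂ) (he : ∀ j, ‖e j‖ = 1)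
    (flip : Fin 5 → ℕ) (P : ℂ) : SimilaritySystem 5 :=
  affineSystem (partRatio α) e (partialSums (partEnd (partRatio α) e flip P)) flip
    (partRatio_mem hc) he

lemma dimH_chainSystem_le {α : ℝ} (hc : 0 ≤ Real.cos α) (e : Fin 5 → ℂ) (he : ∀ j, ‖e j‖ = 1)
    (flip : Fin 5 → ℕ) (P : ℂ) :
    dimH (chainSystem hc e he flip P).attractor ≤ ENNReal.ofReal (dimValue α) :=
  SimilaritySystem.dimH_attractor_le _ (dimValue_pos hc) (sum_partRatio_rpow hc)

/-- The open set condition at angle zero. -/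
lemma exists_openSet_of_real {α : ℝ} (hc : 0 ≤ Real.cos α) (e : Fin 5 → ℂ) (he : ∀ j, ‖e j‖ = 1)
    (flip : Fin 5 → ℕ) (P : ℝ) (hP : 0 < P) (he1 : ∀ j, e j = 1)
    (hsum : ∑ j, partRatio α j = 1) :
    ∃ U : Set ℂ, IsOpen U ∧ U.Nonempty ∧
      (∀ j, (chainSystem hc e he flip P).map j '' U ⊆ U) ∧
      Pairwise fun j k => Disjoint ((chainSystem hc e he flip P).map j '' U)
        ((chainSystem hc e he flip P).map k '' U) := by
  have hre : ∀ k z, (cj k z).re = z.re := fun k z => by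
    rcases Nat.even_or_odd k with h | h
    · rw [cj_of_even h]
    · rw [cj_of_odd h, Complex.conj_re]
  have h1 := scalingRatio_pos hc
  set R := scalingRatio α with hR
  have hs : 4 * R + R ^ 2 = 1 := by
    rw [← hsum]
    simp only [partRatio, Fin.sum_univ_five, Matrix.cons_val]
    ring
  have hsq : ((R : ℂ) ^ 2).re = R ^ 2 := by norm_cast
  have hmap : ∀ j z, ((chainSystem hc e he flip P).map j z).re = partRatio α j * z.re +
      (![0, R, 2 * R, 2 * R + R ^ 2, 3 * R + R ^ 2] : Fin 5 → ℝ) j * P := by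
    intro j z
    simp only [chainSystem, affineSystem, he1, mul_one, Complex.add_re, Complex.re_ofReal_mul, hre]
    congr 1
    fin_cases j <;> simp [partialSums, partEnd, he1, partRatio, ← hR, hsq] <;> ring
  -- The parts follow each other along the real axis and their ratios sum to 1, so the projections
  -- of the images of this strip are consecutive intervals that fill (0, P) up to endpoints.
  refine ⟨{z | 0 < z.re ∧ z.re < P}, ?_, ⟨(P / 2 : ℝ), ?_⟩, ?_, ?_⟩
  · exact (isOpen_lt continuous_const Complex.continuous_re).inter
      (isOpen_lt Complex.continuous_re continuous_const)
  · simp only [Set.mem_ofPred_eq, Complex.ofReal_re]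
    constructor <;> linarith
  · rintro j _ ⟨z, ⟨hz0, hz1⟩, rfl⟩
    have h2 := mul_pos h1 hz0
    have h3 := mul_lt_mul_of_pos_left hz1 h1
    have h4 := mul_pos (pow_pos h1 2) hz0
    have h5 := mul_lt_mul_of_pos_left hz1 (pow_pos h1 2)
    have h6 := mul_pos h1 hP
    have h7 := mul_pos (pow_pos h1 2) hP
    have h8 : 4 * (R * P) + R ^ 2 * P = P := by linear_combination P * hs
    simp only [Set.mem_ofPred_eq, hmap]
    fin_cases j <;> simp [partRatio, ← hR] <;> constructor <;> nlinarith
  · intro j k hjk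
    rw [Set.disjoint_left]
    rintro _ ⟨z, ⟨hz0, hz1⟩, rfl⟩ ⟨w, ⟨hw0, hw1⟩, hzw⟩
    have h := congrArg Complex.re hzw
    simp only [hmap] at h
    have h2 := mul_pos h1 hz0
    have h3 := mul_lt_mul_of_pos_left hz1 h1
    have h4 := mul_pos (pow_pos h1 2) hz0
    have h5 := mul_lt_mul_of_pos_left hz1 (pow_pos h1 2)
    have h2' := mul_pos h1 hw0
    have h3' := mul_lt_mul_of_pos_left hw1 h1
    have h4' := mul_pos (pow_pos h1 2) hw0
    have h5' := mul_lt_mul_of_pos_left hw1 (pow_pos h1 2)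
    have h6 := mul_pos h1 hP
    have h7 := mul_pos (pow_pos h1 2) hP
    fin_cases j <;> fin_cases k <;> simp [partRatio, ← hR] at h hjk <;> linarith

end FibonacciFractal

end

/-! ### The open set condition in oblique coordinates. -/

noncomputable section

open Filter Topology

namespace FibonacciFractal

/-- The coordinates of a point with respect to the basis `conj u`, `u`. -/
lemma exists_coordinates {α : ℝ} (hC : Real.cos (α / 2) ≠ 0) (hS : Real.sin (α / 2) ≠ 0) :
    ∃ X Y : ℂ → ℝ, Continuous X ∧ Continuous Y ∧
      (∀ w, w = X w * starRingEnd ℂ (halfTurn α) + Y w * halfTurn α) ∧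
      ∀ x y : ℝ, X (x * starRingEnd ℂ (halfTurn α) + y * halfTurn α) = x ∧
        Y (x * starRingEnd ℂ (halfTurn α) + y * halfTurn α) = y := by
  refine ⟨fun w => (w.re / Real.cos (α / 2) - w.im / Real.sin (α / 2)) / 2,
    fun w => (w.re / Real.cos (α / 2) + w.im / Real.sin (α / 2)) / 2, by fun_prop, by fun_prop,
    fun w => ?_, fun x y => ⟨?_, ?_⟩⟩
  · apply Complex.ext
    · simp only [Complex.add_re, Complex.re_ofReal_mul, Complex.conj_re, halfTurn_re]
      field_simp
      ring
    · simp only [Complex.add_im, Complex.im_ofReal_mul, Complex.conj_im, halfTurn_im]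
      field_simp
      ring
  all_goals
    simp only [Complex.add_re, Complex.re_ofReal_mul, Complex.conj_re, halfTurn_re, Complex.add_im,
      Complex.im_ofReal_mul, Complex.conj_im, halfTurn_im]
    field_simp
    ring

variable {α : ℝ}

/-- With u = exp(iα/2) and v its conjugate, uv = 1 and u² + v² = 2 cos α reduce every rotation to
real combinations of v and u; the equation for R simplifies the translations. The open set condition
thereby becomes a set of real polynomial inequalities. -/
lemma evenSystem_map (hc : 0 ≤ Real.cos α) (x y : ℝ) (j : Fin 5) :
    (chainSystem hc (evenRot α) (norm_evenRot α) evenFlip (evenEnd α)).map j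
        (x * starRingEnd ℂ (halfTurn α) + y * halfTurn α) =
      ((![scalingRatio α * y,
        scalingRatio α ^ 2 + scalingRatio α * x + 2 * Real.cos α * scalingRatio α * y,
        scalingRatio α + scalingRatio α ^ 2 + 2 * Real.cos α * scalingRatio α ^ 2 +
          scalingRatio α ^ 2 * ((4 * Real.cos α ^ 2 - 1) * x + 2 * Real.cos α * y),
        1 - scalingRatio α - scalingRatio α ^ 2 - 2 * Real.cos α * scalingRatio α ^ 2 +
          scalingRatio α * x + 2 * Real.cos α * scalingRatio α * y,
        1 - scalingRatio α ^ 2 + scalingRatio α * y] : Fin 5 → ℝ) j : ℝ) *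
        starRingEnd ℂ (halfTurn α) +
      ((![scalingRatio α * x, scalingRatio α - scalingRatio α * y,
        scalingRatio α - scalingRatio α ^ 2 - scalingRatio α ^ 2 * (2 * Real.cos α * x + y),
        scalingRatio α ^ 2 - scalingRatio α * y,
        scalingRatio α * x] : Fin 5 → ℝ) j : ℝ) * halfTurn α := by
  have h1 := halfTurn_mul_conj α
  have h2 := halfTurn_sq_add α
  have h3 : (scalingRatio α : ℂ) ^ 2 + 2 * (1 + Real.cos α) * scalingRatio α = 1 := by
    exact_mod_cast scalingRatio_sq hc
  have hcv : starRingEnd ℂ (evenEnd α) =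
      halfTurn α + scalingRatio α * starRingEnd ℂ (halfTurn α) := by simp [evenEnd]
  have hcw : starRingEnd ℂ (x * starRingEnd ℂ (halfTurn α) + y * halfTurn α) =
      x * halfTurn α + y * starRingEnd ℂ (halfTurn α) := by simp
  have e1 : starRingEnd ℂ (halfTurn α) ^ 2 * halfTurn α = starRingEnd ℂ (halfTurn α) := by
    linear_combination starRingEnd ℂ (halfTurn α) * h1
  have e3 : starRingEnd ℂ (halfTurn α) ^ 3 =
      2 * Real.cos α * starRingEnd ℂ (halfTurn α) - halfTurn α := by
    linear_combination starRingEnd ℂ (halfTurn α) * h2 - halfTurn α * h1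
  have e4 : starRingEnd ℂ (halfTurn α) ^ 4 * halfTurn α =
      2 * Real.cos α * starRingEnd ℂ (halfTurn α) - halfTurn α := by
    linear_combination starRingEnd ℂ (halfTurn α) ^ 3 * h1 + e3
  have e5 : starRingEnd ℂ (halfTurn α) ^ 5 =
      (4 * Real.cos α ^ 2 - 1) * starRingEnd ℂ (halfTurn α) - 2 * Real.cos α * halfTurn α := by
    linear_combination starRingEnd ℂ (halfTurn α) ^ 2 * e3 - e1 + 2 * Real.cos α * e3
  fin_cases j <;>
    simp only [chainSystem, affineSystem, partRatio, evenRot, evenFlip, partialSums, partEnd,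
      Matrix.cons_val, Fin.zero_eta, Fin.mk_one, Fin.reduceFinMk, cj_zero, cj_one, hcv, hcw] <;>
    (try simp only [evenEnd]) <;> push_cast [-Complex.ofReal_cos] <;>
    generalize starRingEnd ℂ (halfTurn α) = v at * <;>
    generalize halfTurn α = u at * <;>
    generalize (scalingRatio α : ℂ) = R at *
  · ring
  · linear_combination R * x * e1 + R * y * e3
  · linear_combination R * e1 + R ^ 2 * e3 + R ^ 2 * x * e5 + R ^ 2 * y * e4
  · linear_combination R * (1 + x) * e1 + R * (R + y) * e3 + R ^ 2 * e5 + R ^ 3 * e4 +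
      ((2 * Real.cos α * R + 1) * v - R * u) * h3
  · linear_combination 2 * R * e1 + 2 * R ^ 2 * e3 + R ^ 2 * e5 + R ^ 3 * e4 +
      ((2 * Real.cos α * R + 1) * v - R * u) * h3

lemma oddSystem_map (hc : 0 ≤ Real.cos α) (x y : ℝ) (j : Fin 5) :
    (chainSystem hc (oddRot α) (norm_oddRot α) oddFlip (starRingEnd ℂ (halfTurn α))).map j
        (x * starRingEnd ℂ (halfTurn α) + y * halfTurn α) =
      ((![scalingRatio α * y, scalingRatio α * x,
        scalingRatio α + scalingRatio α ^ 2 * x,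
        scalingRatio α + scalingRatio α ^ 2 + scalingRatio α * x,
        2 * scalingRatio α + scalingRatio α ^ 2 +
          scalingRatio α * (2 * Real.cos α * x + (4 * Real.cos α ^ 2 - 1) * y)] :
            Fin 5 → ℝ) j : ℝ) * starRingEnd ℂ (halfTurn α) +
      ((![scalingRatio α * x, scalingRatio α + scalingRatio α * y,
        scalingRatio α + scalingRatio α ^ 2 * y, scalingRatio α + scalingRatio α * y,
        scalingRatio α - scalingRatio α * (x + 2 * Real.cos α * y)] : Fin 5 → ℝ) j : ℝ) *
          halfTurn α := by
  have h1 := halfTurn_mul_conj α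
  have h2 := halfTurn_sq_add α
  have hcw : starRingEnd ℂ (x * starRingEnd ℂ (halfTurn α) + y * halfTurn α) =
      x * halfTurn α + y * starRingEnd ℂ (halfTurn α) := by simp
  have e3 : starRingEnd ℂ (halfTurn α) ^ 3 =
      2 * Real.cos α * starRingEnd ℂ (halfTurn α) - halfTurn α := by
    linear_combination starRingEnd ℂ (halfTurn α) * h2 - halfTurn α * h1
  have e4 : starRingEnd ℂ (halfTurn α) ^ 4 * halfTurn α =
      2 * Real.cos α * starRingEnd ℂ (halfTurn α) - halfTurn α := by
    linear_combination starRingEnd ℂ (halfTurn α) ^ 3 * h1 + e3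
  have e5 : starRingEnd ℂ (halfTurn α) ^ 5 =
      (4 * Real.cos α ^ 2 - 1) * starRingEnd ℂ (halfTurn α) - 2 * Real.cos α * halfTurn α := by
    linear_combination starRingEnd ℂ (halfTurn α) ^ 2 * e3 -
      starRingEnd ℂ (halfTurn α) * h1 + 2 * Real.cos α * e3
  fin_cases j <;>
    simp only [chainSystem, affineSystem, partRatio, oddRot, oddFlip, partialSums, partEnd,
      Matrix.cons_val, Fin.zero_eta, Fin.mk_one, Fin.reduceFinMk, cj_zero, cj_one, hcw,
      Complex.conj_conj] <;>
    push_cast [-Complex.ofReal_cos] <;>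
    generalize starRingEnd ℂ (halfTurn α) = v at * <;>
    generalize halfTurn α = u at * <;>
    generalize (scalingRatio α : ℂ) = R at *
  · ring
  · ring
  · ring
  · ring
  · linear_combination R * x * e4 + R * y * e5

/-- A system which maps a product set in coordinates to disjoint parts of itself satisfies the
open set condition. -/
lemma exists_openSet_of_coordinates (hC : Real.cos (α / 2) ≠ 0) (hS : Real.sin (α / 2) ≠ 0)
    (T : SimilaritySystem 5) (f g : Fin 5 → ℝ → ℝ → ℝ) (V : Set (ℝ × ℝ)) (hV : IsOpen V)
    (hVne : V.Nonempty)
    (hmap : ∀ j (x y : ℝ), T.map j (x * starRingEnd ℂ (halfTurn α) + y * halfTurn α) =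
      f j x y * starRingEnd ℂ (halfTurn α) + g j x y * halfTurn α)
    (hmem : ∀ j x y, (x, y) ∈ V → (f j x y, g j x y) ∈ V)
    (hdis : ∀ j k x y x' y', (x, y) ∈ V → (x', y') ∈ V → f j x y = f k x' y' →
      g j x y = g k x' y' → j = k) :
    ∃ U : Set ℂ, IsOpen U ∧ U.Nonempty ∧ (∀ j, T.map j '' U ⊆ U) ∧
      Pairwise fun j k => Disjoint (T.map j '' U) (T.map k '' U) := by
  obtain ⟨X, Y, hX, hY, hXY, hco⟩ := exists_coordinates hC hS
  have hXm : ∀ j w, X (T.map j w) = f j (X w) (Y w) := fun j w => by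
    conv_lhs => rw [hXY w, hmap]
    exact (hco _ _).1
  have hYm : ∀ j w, Y (T.map j w) = g j (X w) (Y w) := fun j w => by
    conv_lhs => rw [hXY w, hmap]
    exact (hco _ _).2
  refine ⟨(fun w => (X w, Y w)) ⁻¹' V, hV.preimage (hX.prodMk hY), ?_, ?_, ?_⟩
  · obtain ⟨⟨x, y⟩, h⟩ := hVne
    exact ⟨x * starRingEnd ℂ (halfTurn α) + y * halfTurn α, by
      rwa [Set.mem_preimage, (hco x y).1, (hco x y).2]⟩
  · rintro j _ ⟨w, hw, rfl⟩
    rw [Set.mem_preimage, hXm, hYm]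
    exact hmem j _ _ hw
  · intro j k hjk
    rw [Set.disjoint_left]
    rintro _ ⟨z, hz, rfl⟩ ⟨w, hw, hzw⟩
    exact hjk (hdis k j _ _ _ _ hw hz (by rw [← hXm, ← hXm, hzw]) (by rw [← hYm, ← hYm, hzw])).symm

lemma exists_openSet_even (hc : 0 ≤ Real.cos α) (hC : Real.cos (α / 2) ≠ 0)
    (hS : Real.sin (α / 2) ≠ 0) :
    ∃ U : Set ℂ, IsOpen U ∧ U.Nonempty ∧
      (∀ j, (chainSystem hc (evenRot α) (norm_evenRot α) evenFlip (evenEnd α)).map j '' U ⊆ U) ∧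
      Pairwise fun j k => Disjoint
        ((chainSystem hc (evenRot α) (norm_evenRot α) evenFlip (evenEnd α)).map j '' U)
        ((chainSystem hc (evenRot α) (norm_evenRot α) evenFlip (evenEnd α)).map k '' U) := by
  have hR := scalingRatio_pos hc
  have hR2 := scalingRatio_lt hc
  have hrel := scalingRatio_sq hc
  -- The open parallelogram with opposite corners 0 and `evenEnd α`, the first and last point of the
  -- fractal.
  refine exists_openSet_of_coordinates hC hS _ _ _
    {p : ℝ × ℝ | (0 < p.1 ∧ p.1 < 1) ∧ 0 < p.2 ∧ p.2 < scalingRatio α} ?_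
    ⟨(1 / 2, scalingRatio α / 2), by constructor <;> constructor <;> simp <;> linarith⟩
    (fun j x y => evenSystem_map hc x y j) ?_ ?_
  · exact ((isOpen_lt continuous_const continuous_fst).inter
      (isOpen_lt continuous_fst continuous_const)).inter
      ((isOpen_lt continuous_const continuous_snd).inter
      (isOpen_lt continuous_snd continuous_const))
  · rintro j x y ⟨⟨hx0, hx1⟩, hy0, hy1⟩
    simp only at hx0 hx1 hy0 hy1
    simp only [Set.mem_ofPred_eq]
    generalize scalingRatio α = R at *
    generalize Real.cos α = c at *
    obtain ⟨hRx0, hRx1⟩ : 0 < R * x ∧ R * x < R := ⟨by positivity, by nlinarith⟩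
    obtain ⟨hRy0, hRy1⟩ : 0 < R * y ∧ R * y < R ^ 2 := ⟨by positivity, by nlinarith⟩
    have hcR := mul_nonneg hc hR.le
    have hRR := pow_pos hR 2
    have hRRR := pow_pos hR 3
    have hcRR := mul_nonneg hcR hR.le
    obtain ⟨hcRy0, hcRy1⟩ : 0 ≤ c * (R * y) ∧ c * (R * y) ≤ c * R ^ 2 :=
      ⟨by positivity, mul_le_mul_of_nonneg_left hRy1.le hc⟩
    have hrel2 : R ^ 3 + 2 * R ^ 2 + 2 * c * R ^ 2 = R := by linear_combination R * hrel
    have hrel3 : c * R ^ 3 + 2 * c * R ^ 2 + 2 * c ^ 2 * R ^ 2 = c * R := by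
      linear_combination c * R * hrel
    obtain ⟨hRRx0, hRRx1⟩ : 0 < R * (R * x) ∧ R * (R * x) < R ^ 2 :=
      ⟨by positivity, by nlinarith⟩
    obtain ⟨hRRy0, hRRy1⟩ : 0 < R * (R * y) ∧ R * (R * y) < R ^ 3 :=
      ⟨by positivity, by nlinarith⟩
    obtain ⟨hcRRx0, hcRRx1⟩ : 0 ≤ c * (R * (R * x)) ∧ c * (R * (R * x)) ≤ c * R ^ 2 :=
      ⟨by positivity, mul_le_mul_of_nonneg_left hRRx1.le hc⟩
    obtain ⟨hcRRy0, hcRRy1⟩ : 0 ≤ c * (R * (R * y)) ∧ c * (R * (R * y)) ≤ c * R ^ 3 :=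
      ⟨by positivity, mul_le_mul_of_nonneg_left hRRy1.le hc⟩
    obtain ⟨hccRRx0, hccRRx1⟩ : 0 ≤ c ^ 2 * (R * (R * x)) ∧ c ^ 2 * (R * (R * x)) ≤ c ^ 2 * R ^ 2 :=
      ⟨by positivity, mul_le_mul_of_nonneg_left hRRx1.le (sq_nonneg c)⟩
    fin_cases j <;> simp only [Matrix.cons_val, Fin.zero_eta, Fin.mk_one, Fin.reduceFinMk] <;>
      refine ⟨⟨?_, ?_⟩, ?_, ?_⟩ <;> linarith
  · rintro j k x y x' y' ⟨⟨hx0, hx1⟩, hy0, hy1⟩ ⟨⟨hx0', hx1'⟩, hy0', hy1'⟩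
    simp only at hx0 hx1 hy0 hy1 hx0' hx1' hy0' hy1'
    generalize scalingRatio α = R at *
    generalize Real.cos α = c at *
    have hcR := mul_nonneg hc hR.le
    have hRR := pow_pos hR 2
    have hcRR := mul_nonneg hcR hR.le
    have hrel2 : R ^ 3 + 2 * R ^ 2 + 2 * c * R ^ 2 = R := by linear_combination R * hrel
    have hrel3 : c * R ^ 3 + 2 * c * R ^ 2 + 2 * c ^ 2 * R ^ 2 = c * R := by
      linear_combination c * R * hrel
    have hR2' : R ^ 2 < R := by nlinarith
    have key : ∀ x y : ℝ, 0 < x → x < 1 → 0 < y → y < R →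
        (0 < R * x ∧ R * x < R) ∧ (0 < R * y ∧ R * y < R ^ 2) ∧
        (0 ≤ c * (R * y) ∧ c * (R * y) ≤ c * R ^ 2) ∧
        (0 < R * (R * x) ∧ R * (R * x) < R ^ 2) ∧ (0 < R * (R * y) ∧ R * (R * y) < R ^ 3) ∧
        (0 ≤ c * (R * (R * x)) ∧ c * (R * (R * x)) ≤ c * R ^ 2) ∧
        c * (R * (R * y)) ≤ c * R ^ 3 ∧ c ^ 2 * (R * (R * x)) ≤ c ^ 2 * R ^ 2 ∧
        0 ≤ c * (R * (R * y)) ∧ 0 ≤ c ^ 2 * (R * (R * x)) := by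
      intro x y hx0 hx1 hy0 hy1
      have h1 : R * x < R := by nlinarith
      have h2 : R * y < R ^ 2 := by nlinarith
      have h3 : R * (R * x) < R ^ 2 := by nlinarith
      have h4 : R * (R * y) < R ^ 3 := by nlinarith
      exact ⟨⟨by positivity, h1⟩, ⟨by positivity, h2⟩,
        ⟨by positivity, mul_le_mul_of_nonneg_left h2.le hc⟩, ⟨by positivity, h3⟩,
        ⟨by positivity, h4⟩, ⟨by positivity, mul_le_mul_of_nonneg_left h3.le hc⟩,
        mul_le_mul_of_nonneg_left h4.le hc, mul_le_mul_of_nonneg_left h3.le (sq_nonneg c),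
        by positivity, by positivity⟩
    obtain ⟨⟨a1, a2⟩, ⟨a3, a4⟩, ⟨a5, a6⟩, ⟨a7, a8⟩, ⟨a9, a10⟩, ⟨a11, a12⟩, a13, a14, a15, a16⟩ :=
      key x y hx0 hx1 hy0 hy1
    obtain ⟨⟨b1, b2⟩, ⟨b3, b4⟩, ⟨b5, b6⟩, ⟨b7, b8⟩, ⟨b9, b10⟩, ⟨b11, b12⟩, b13, b14, b15, b16⟩ :=
      key x' y' hx0' hx1' hy0' hy1'
    intro h1 h2
    clear key
    fin_cases j <;> fin_cases k <;>
      simp only [Matrix.cons_val, Fin.zero_eta, Fin.mk_one, Fin.reduceFinMk] at h1 h2 ⊢ <;>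
      exfalso <;> linarith

lemma exists_openSet_odd (hc : 0 ≤ Real.cos α) (hC : Real.cos (α / 2) ≠ 0)
    (hS : Real.sin (α / 2) ≠ 0) :
    ∃ U : Set ℂ, IsOpen U ∧ U.Nonempty ∧
      (∀ j, (chainSystem hc (oddRot α) (norm_oddRot α) oddFlip
        (starRingEnd ℂ (halfTurn α))).map j '' U ⊆ U) ∧
      Pairwise fun j k => Disjoint
        ((chainSystem hc (oddRot α) (norm_oddRot α) oddFlip
          (starRingEnd ℂ (halfTurn α))).map j '' U)
        ((chainSystem hc (oddRot α) (norm_oddRot α) oddFlip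
          (starRingEnd ℂ (halfTurn α))).map k '' U) := by
  have hR := scalingRatio_pos hc
  have hR2 := scalingRatio_lt hc
  have hrel := scalingRatio_sq hc
  have hc1 := Real.cos_le_one α
  -- A trapezoid on the base from 0 to the endpoint (1, 0). Its height R / (1 - R) is the fixed
  -- point of y ↦ R + R y, the second coordinate of the second and fourth maps.
  refine exists_openSet_of_coordinates hC hS _ _ _
    {p : ℝ × ℝ | 0 < p.1 ∧ 0 < p.2 ∧ (1 - scalingRatio α) * p.2 < scalingRatio α ∧
      p.1 + 2 * Real.cos α * p.2 < 1} ?_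
    ⟨(1 / 4, scalingRatio α / 4), ⟨by norm_num, by simp only; linarith, by simp only; nlinarith,
      by simp only; nlinarith⟩⟩
    (fun j x y => oddSystem_map hc x y j) ?_ ?_
  · exact (isOpen_lt continuous_const continuous_fst).inter
      ((isOpen_lt continuous_const continuous_snd).inter
      ((isOpen_lt (continuous_const.mul continuous_snd) continuous_const).inter
      (isOpen_lt (continuous_fst.add (continuous_const.mul continuous_snd)) continuous_const)))
  · rintro j x y ⟨hx0, hy0, hy1, hxy⟩
    simp only at hx0 hy0 hy1 hxy
    simp only [Set.mem_ofPred_eq]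
    generalize scalingRatio α = R at *
    generalize Real.cos α = c at *
    have hcy0 := mul_nonneg hc hy0.le
    have hx1 : x < 1 := by linarith
    have hRx0 := mul_pos hR hx0
    have hRy0 := mul_pos hR hy0
    have hRx1 : R * x < R := by nlinarith
    have hRxy : R * (x + 2 * c * y) < R := by nlinarith
    have hRxy0 : 0 < R * (x + 2 * c * y) := by positivity
    have hRRx0 := mul_pos hR hRx0
    have hRRy0 := mul_pos hR hRy0
    have hRRx1 : R * (R * x) < R ^ 2 := by nlinarith
    have hRRxy : R * (R * (x + 2 * c * y)) < R ^ 2 := by nlinarith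
    have hcR := mul_nonneg hc hR.le
    have hRR := pow_pos hR 2
    have hy2 : y < 1 := by nlinarith
    have hRy1 : R * y < R := by nlinarith
    have hcxy : 0 ≤ c * (R * (x + 2 * c * y)) := by positivity
    have hRyy : R * ((1 - R) * y) < R ^ 2 := by nlinarith
    have hRRyy : R * (R * ((1 - R) * y)) < R ^ 2 := by nlinarith
    have hcRx : c * (R * x) ≤ c * R := mul_le_mul_of_nonneg_left hRx1.le hc
    have hR1x : (1 - R) * (R * x) < R := by nlinarith
    have hR1xy : 0 < (1 - R) * (R * (x + 2 * c * y)) := mul_pos (by linarith) hRxy0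
    fin_cases j <;> simp only [Matrix.cons_val, Fin.zero_eta, Fin.mk_one, Fin.reduceFinMk] <;>
      refine ⟨?_, ?_, ?_, ?_⟩ <;> linarith
  · rintro j k x y x' y' ⟨hx0, hy0, hy1, hxy⟩ ⟨hx0', hy0', hy1', hxy'⟩
    simp only at hx0 hy0 hy1 hxy hx0' hy0' hy1' hxy'
    generalize scalingRatio α = R at *
    generalize Real.cos α = c at *
    have hcR := mul_nonneg hc hR.le
    have hRR := pow_pos hR 2
    have hR2' : R ^ 2 < R := by nlinarith
    have key : ∀ x y : ℝ, 0 < x → 0 < y → (1 - R) * y < R → x + 2 * c * y < 1 →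
        (0 < R * x ∧ R * x < R) ∧ (0 < R * y ∧ 2 * (R * y) < 2 * R + R ^ 2) ∧
        (0 < R * (R * x) ∧ R * (R * x) < R ^ 2) ∧ 0 < R * (R * y) ∧
        0 < R * (x + 2 * c * y) ∧ 0 ≤ c * (R * (x + 2 * c * y)) := by
      intro x y hx0 hy0 hy1 hxy
      have hcy0 := mul_nonneg hc hy0.le
      have h1 : R * x < R := by nlinarith
      have h2 : y < 1 := by nlinarith
      have h3 : R * (R * x) < R ^ 2 := by nlinarith
      exact ⟨⟨by positivity, h1⟩, ⟨by positivity, by nlinarith⟩, ⟨by positivity, h3⟩,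
        by positivity, by positivity, by positivity⟩
    obtain ⟨⟨a1, a2⟩, ⟨a3, a4⟩, ⟨a5, a6⟩, a7, a8, a9⟩ := key x y hx0 hy0 hy1 hxy
    obtain ⟨⟨b1, b2⟩, ⟨b3, b4⟩, ⟨b5, b6⟩, b7, b8, b9⟩ := key x' y' hx0' hy0' hy1' hxy'
    intro h1 h2
    clear key
    fin_cases j <;> fin_cases k <;>
      simp only [Matrix.cons_val, Fin.zero_eta, Fin.mk_one, Fin.reduceFinMk] at h1 h2 ⊢ <;>
      exfalso <;> linarith

end FibonacciFractal

end

/-! ### Dimensions of the two attractors. -/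

noncomputable section

open Filter Topology

namespace FibonacciFractal

/-- The fractal given by the words of even length. -/
def evenFractal {α : ℝ} (hc : 0 ≤ Real.cos α) : SimilaritySystem 5 :=
  chainSystem hc (evenRot α) (norm_evenRot α) evenFlip (evenEnd α)

/-- The fractal given by the words of odd length. -/
def oddFractal {α : ℝ} (hc : 0 ≤ Real.cos α) : SimilaritySystem 5 :=
  chainSystem hc (oddRot α) (norm_oddRot α) oddFlip (starRingEnd ℂ (halfTurn α))

variable {α : ℝ}

lemma cos_nonneg_of_mem (hα : α ∈ Set.Icc (0 : ℝ) (Real.pi / 2)) : 0 ≤ Real.cos α :=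
  Real.cos_nonneg_of_neg_pi_div_two_le_of_le (by linarith [hα.1, Real.pi_pos]) hα.2

lemma cos_half_pos (hα : α ∈ Set.Icc (0 : ℝ) (Real.pi / 2)) : 0 < Real.cos (α / 2) :=
  Real.cos_pos_of_mem_Ioo ⟨by linarith [hα.1, Real.pi_pos], by linarith [hα.2, Real.pi_pos]⟩

lemma sin_half_pos (hα : α ∈ Set.Icc (0 : ℝ) (Real.pi / 2)) (h0 : α ≠ 0) :
    0 < Real.sin (α / 2) :=
  Real.sin_pos_of_pos_of_lt_pi (by linarith [lt_of_le_of_ne hα.1 h0.symm])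
    (by linarith [hα.2, Real.pi_pos])

lemma halfTurn_zero : halfTurn 0 = 1 := by simp [halfTurn]

lemma sum_partRatio_zero : ∑ j, partRatio 0 j = 1 := by
  have := scalingRatio_sq (α := 0) (by simp)
  rw [Real.cos_zero] at this
  simp only [partRatio, Fin.sum_univ_five, Matrix.cons_val]
  linear_combination this

theorem dimH_evenFractal (hα : α ∈ Set.Icc (0 : ℝ) (Real.pi / 2)) (hc : 0 ≤ Real.cos α) :
    dimH (evenFractal hc).attractor = ENNReal.ofReal (dimValue α) := by
  refine le_antisymm (dimH_chainSystem_le hc _ _ _ _) ?_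
  obtain ⟨U, h1, h2, h3, h4⟩ : ∃ U : Set ℂ, IsOpen U ∧ U.Nonempty ∧
      (∀ j, (evenFractal hc).map j '' U ⊆ U) ∧
      Pairwise fun j k => Disjoint ((evenFractal hc).map j '' U) ((evenFractal hc).map k '' U) := by
    rcases eq_or_ne α 0 with rfl | h0
    -- At angle zero the coordinate directions coincide, so the strip replaces the parallelogram.
    · have hP : evenEnd 0 = ((1 + scalingRatio 0 : ℝ) : ℂ) := by simp [evenEnd, halfTurn_zero]
      unfold evenFractal
      rw [hP]
      refine exists_openSet_of_real hc _ _ _ _ (by linarith [scalingRatio_pos hc]) (fun j => ?_)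
        sum_partRatio_zero
      fin_cases j <;> simp [evenRot, halfTurn_zero]
    · exact exists_openSet_even hc (cos_half_pos hα).ne' (sin_half_pos hα h0).ne'
  exact SimilaritySystem.le_dimH_attractor _ (dimValue_pos hc) (sum_partRatio_rpow hc) h1 h2 h3 h4

theorem dimH_oddFractal (hα : α ∈ Set.Icc (0 : ℝ) (Real.pi / 2)) (hc : 0 ≤ Real.cos α) :
    dimH (oddFractal hc).attractor = ENNReal.ofReal (dimValue α) := by
  refine le_antisymm (dimH_chainSystem_le hc _ _ _ _) ?_
  obtain ⟨U, h1, h2, h3, h4⟩ : ∃ U : Set ℂ, IsOpen U ∧ U.Nonempty ∧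
      (∀ j, (oddFractal hc).map j '' U ⊆ U) ∧
      Pairwise fun j k => Disjoint ((oddFractal hc).map j '' U) ((oddFractal hc).map k '' U) := by
    rcases eq_or_ne α 0 with rfl | h0
    · have hP : starRingEnd ℂ (halfTurn 0) = ((1 : ℝ) : ℂ) := by simp [halfTurn_zero]
      unfold oddFractal
      rw [hP]
      refine exists_openSet_of_real hc _ _ _ _ one_pos (fun j => ?_) sum_partRatio_zero
      fin_cases j <;> simp [oddRot, halfTurn_zero]
    · exact exists_openSet_odd hc (cos_half_pos hα).ne' (sin_half_pos hα h0).ne'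
  exact SimilaritySystem.le_dimH_attractor _ (dimValue_pos hc) (sum_partRatio_rpow hc) h1 h2 h3 h4

end FibonacciFractal

end

/-! ### Curves of words as compositions of motions; combinatorics of the words. -/

noncomputable section

open Filter Topology

namespace FibonacciFractal

/-- The rotation which a letter at an odd position causes. -/
def rot (τ : ℂ) (b : Bool) : ℂ := if b then 1 else τ

/-- The linear part of the motion which takes the initial frame of the curve of a word to its final
frame.  Each letter acts by a reflected motion with translation part `ρ` and linear part
`ρ ^ 2 * rot τ b`; the parameter `ρ` is a choice of the initial frame. -/
def lin (ρ τ : ℂ) : List Bool → ℂ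
  | [] => 1
  | b :: w => ρ ^ 2 * rot τ b * starRingEnd ℂ (lin ρ τ w)

/-- The displacement of the final frame of the curve of a word. -/
def disp (ρ τ : ℂ) : List Bool → ℂ
  | [] => 0
  | b :: w => ρ + ρ ^ 2 * rot τ b * starRingEnd ℂ (disp ρ τ w)

/-- The curve of a word in the frame chosen by `ρ`. -/
def path (ρ τ : ℂ) : List Bool → Set ℂ
  | [] => {0}
  | b :: w => segment ℝ 0 ρ ∪ (fun z => ρ + ρ ^ 2 * rot τ b * starRingEnd ℂ z) '' path ρ τ w

section Append

variable (ρ τ : ℂ)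

lemma cj_succ (k : ℕ) (z : ℂ) : cj (k + 1) z = starRingEnd ℂ (cj k z) := by
  rw [add_comm, cj_add, cj_one]

lemma lin_append (v w : List Bool) :
    lin ρ τ (v ++ w) = lin ρ τ v * cj v.length (lin ρ τ w) := by
  induction v with
  | nil => simp [lin]
  | cons b v ih =>
    simp only [List.cons_append, lin, ih, List.length_cons, cj_succ, map_mul]
    ring

lemma disp_append (v w : List Bool) :
    disp ρ τ (v ++ w) = disp ρ τ v + lin ρ τ v * cj v.length (disp ρ τ w) := by
  induction v with
  | nil => simp [lin, disp]
  | cons b v ih =>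
    simp only [List.cons_append, lin, disp, ih, List.length_cons, cj_succ, map_mul, map_add]
    ring

lemma zero_mem_path (w : List Bool) : 0 ∈ path ρ τ w := by
  cases w with
  | nil => exact Set.mem_singleton 0
  | cons b w => exact Or.inl (left_mem_segment ℝ 0 ρ)

lemma path_append (v w : List Bool) :
    path ρ τ (v ++ w) =
      path ρ τ v ∪ (fun z => disp ρ τ v + lin ρ τ v * cj v.length z) '' path ρ τ w := by
  induction v with
  | nil =>
    simp only [List.nil_append, path, lin, disp, List.length_nil, cj_zero, one_mul, zero_add,
      Set.image_id', Set.singleton_union]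
    exact (Set.insert_eq_of_mem (zero_mem_path ρ τ w)).symm
  | cons b v ih =>
    simp only [List.cons_append, path, ih, Set.image_union, Set.union_assoc, Set.image_image]
    congr 2
    refine Set.image_congr fun z _ => ?_
    simp only [lin, disp, List.length_cons, cj_succ, map_mul, map_add]
    ring

lemma norm_rot {τ : ℂ} (hτ : ‖τ‖ = 1) (b : Bool) : ‖rot τ b‖ = 1 := by
  cases b <;> simp [rot, hτ]

variable {ρ τ}

lemma norm_lin (hρ : ‖ρ‖ = 1) (hτ : ‖τ‖ = 1) (w : List Bool) : ‖lin ρ τ w‖ = 1 := by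
  induction w with
  | nil => simp [lin]
  | cons b w ih => simp [lin, hρ, norm_rot hτ, ih]

lemma norm_le_of_mem_path (hρ : ‖ρ‖ = 1) (hτ : ‖τ‖ = 1) (w : List Bool) :
    ∀ z ∈ path ρ τ w, ‖z‖ ≤ w.length := by
  induction w with
  | nil => simp [path]
  | cons b w ih =>
    rintro z (hz | ⟨y, hy, rfl⟩)
    · have : segment ℝ 0 ρ ⊆ Metric.closedBall 0 1 :=
        (convex_closedBall (0 : ℂ) 1).segment_subset (by simp) (by simp [hρ])
      have h1 := this hz
      rw [mem_closedBall_zero_iff] at h1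
      rw [List.length_cons]
      push_cast
      linarith [(Nat.cast_nonneg w.length : (0 : ℝ) ≤ w.length)]
    · refine (norm_add_le _ _).trans ?_
      rw [norm_mul, norm_mul, norm_pow, hρ, norm_rot hτ, RCLike.norm_conj, List.length_cons]
      push_cast
      linarith [ih y hy]

lemma norm_disp_le (hρ : ‖ρ‖ = 1) (hτ : ‖τ‖ = 1) (w : List Bool) : ‖disp ρ τ w‖ ≤ w.length := by
  induction w with
  | nil => simp [disp]
  | cons b w ih =>
    refine (norm_add_le _ _).trans ?_
    rw [norm_mul, norm_mul, norm_pow, hρ, norm_rot hτ, RCLike.norm_conj, List.length_cons]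
    push_cast
    linarith

lemma norm_disp_append_sub_le (hρ : ‖ρ‖ = 1) (hτ : ‖τ‖ = 1) (p s s' : List Bool)
    (hs : s.length = 2) (hs' : s'.length = 2) :
    ‖disp ρ τ (p ++ s) - disp ρ τ (p ++ s')‖ ≤ 4 := by
  rw [disp_append, disp_append, add_sub_add_left_eq_sub, ← mul_sub, ← map_sub, norm_mul, norm_cj,
    norm_lin hρ hτ, one_mul]
  have h1 := norm_disp_le hρ hτ s
  have h2 := norm_disp_le hρ hτ s'
  rw [hs] at h1
  rw [hs'] at h2
  push_cast at h1 h2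
  exact (norm_sub_le _ _).trans (by linarith)

lemma isometry_motion {e : ℂ} (he : ‖e‖ = 1) (t : ℂ) (k : ℕ) :
    Isometry fun z => t + e * cj k z :=
  Isometry.of_dist_eq fun x y => by
    rw [dist_eq_norm, add_sub_add_left_eq_sub, ← mul_sub, ← map_sub, norm_mul, norm_cj, he,
      one_mul, dist_eq_norm]

/-- The common prefix places both tails by the same isometry, and both tails start at 0 and have
length two. -/
lemma hausdorffEDist_path_append_le (hρ : ‖ρ‖ = 1) (hτ : ‖τ‖ = 1) (p s s' : List Bool)
    (hs : s.length = 2) (hs' : s'.length = 2) :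
    Metric.hausdorffEDist (path ρ τ (p ++ s)) (path ρ τ (p ++ s')) ≤ 4 := by
  have key : ∀ s : List Bool, s.length = 2 → ∀ s' : List Bool, ∀ x ∈ path ρ τ s,
      ∃ y ∈ path ρ τ s', edist x y ≤ 4 := by
    intro s hs s' x hx
    refine ⟨0, zero_mem_path ρ τ s', ?_⟩
    have h := norm_le_of_mem_path hρ hτ s x hx
    rw [hs] at h
    rw [edist_dist, dist_zero_right]
    refine ENNReal.ofReal_le_of_le_toReal (h.trans ?_)
    norm_num
  rw [path_append, path_append]
  refine Metric.hausdorffEDist_union_le.trans (max_le (by simp) ?_)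
  rw [Metric.hausdorffEDist_image (isometry_motion (norm_lin hρ hτ p) _ _)]
  exact Metric.hausdorffEDist_le_of_mem_edist (key s hs s') (key s' hs' s)

end Append

section Curve

variable {α : ℝ} {ρ : ℂ}

lemma turn_succ (α : ℝ) (j : ℕ) (b : Bool) : turn α (j + 1) b = -turn α j b := by
  cases b
  · by_cases h : Even j <;> simp [turn, Nat.even_add_one, h]
  · simp [turn]

lemma direction_cons (α : ℝ) (b : Bool) (w : List Bool) (l : ℕ) :
    direction α (b :: w) (l + 1) = turn α 1 b + Real.pi - direction α w l := by
  rw [direction, direction, Finset.sum_range_succ']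
  simp only [List.getD_cons_succ, List.getD_cons_zero, turn_succ α (_ + 1), Finset.sum_neg_distrib,
    zero_add]
  ring

lemma exp_turn_one (α : ℝ) (b : Bool) :
    Complex.exp ((turn α 1 b : ℂ) * Complex.I) = rot (starRingEnd ℂ (halfTurn α) ^ 2) b := by
  cases b
  · simp only [turn, rot, halfTurn, Bool.false_eq_true, if_false, Nat.not_even_one]
    rw [← Complex.exp_conj, ← Complex.exp_nat_mul, map_mul, Complex.conj_ofReal, Complex.conj_I]
    congr 1
    push_cast
    ring
  · simp [turn, rot]

/-- Removing the first letter changes the parity of every position and so reverses all later turns.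
A direction θ becomes π - θ plus the first turn, and exp(i(π - θ)) is minus the conjugate of
exp(iθ). -/
lemma vertex_cons (α : ℝ) (b : Bool) (w : List Bool) (m : ℕ) :
    vertex α (b :: w) (m + 1) = Complex.I -
      rot (starRingEnd ℂ (halfTurn α) ^ 2) b * starRingEnd ℂ (vertex α w m) := by
  rw [vertex, Finset.sum_range_succ', vertex, map_sum, Finset.mul_sum, sub_eq_neg_add,
    ← Finset.sum_neg_distrib]
  congr 1
  · refine Finset.sum_congr rfl fun l _ => ?_
    rw [direction_cons, ← exp_turn_one, ← Complex.exp_conj, ← Complex.exp_add, map_mul,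
      Complex.conj_ofReal, Complex.conj_I]
    have : (((turn α 1 b + Real.pi - direction α w l : ℝ) : ℂ) * Complex.I) =
        (turn α 1 b * Complex.I + direction α w l * -Complex.I) + Real.pi * Complex.I := by
      push_cast; ring
    rw [this, Complex.exp_add _ (Real.pi * Complex.I), Complex.exp_pi_mul_I]
    ring
  · simp [direction, Complex.exp_pi_div_two_mul_I]

lemma vertex_zero (α : ℝ) (w : List Bool) : vertex α w 0 = 0 := by simp [vertex]

lemma conj_mul_self_of_norm_eq_one (hρ : ‖ρ‖ = 1) : starRingEnd ℂ ρ * ρ = 1 := by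
  rw [mul_comm, Complex.mul_conj, Complex.normSq_eq_norm_sq, hρ]
  simp

lemma vertex_length (hρ : ‖ρ‖ = 1) (w : List Bool) :
    vertex α w w.length =
      Complex.I * starRingEnd ℂ ρ * disp ρ (starRingEnd ℂ (halfTurn α) ^ 2) w := by
  have h := conj_mul_self_of_norm_eq_one hρ
  induction w with
  | nil => simp [vertex, disp]
  | cons b w ih =>
    rw [List.length_cons, vertex_cons, ih, disp]
    simp only [map_mul, Complex.conj_I, Complex.conj_conj]
    linear_combination (-Complex.I - Complex.I * ρ * rot (starRingEnd ℂ (halfTurn α) ^ 2) b *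
      starRingEnd ℂ (disp ρ (starRingEnd ℂ (halfTurn α) ^ 2) w)) * h

lemma width_eq (hρ : ‖ρ‖ = 1) (w : List Bool) :
    width α w = ‖disp ρ (starRingEnd ℂ (halfTurn α) ^ 2) w‖ := by
  rw [width, vertex_zero, dist_zero_left, vertex_length hρ, norm_mul, norm_mul, RCLike.norm_conj,
    hρ, Complex.norm_I, one_mul, one_mul]

lemma image_segment_reflect (e t a b : ℂ) :
    (fun z => t - e * starRingEnd ℂ z) '' segment ℝ a b =
      segment ℝ (t - e * starRingEnd ℂ a) (t - e * starRingEnd ℂ b) := by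
  rw [segment_eq_image, segment_eq_image, Set.image_image]
  refine Set.image_congr fun s _ => ?_
  simp only [Complex.real_smul, map_add, map_mul, Complex.conj_ofReal, Complex.ofReal_sub,
    Complex.ofReal_one, map_sub, map_one]
  ring

lemma image_segment_mul (e a : ℂ) : (fun z => e * z) '' segment ℝ 0 a = segment ℝ 0 (e * a) := by
  rw [segment_eq_image, segment_eq_image, Set.image_image]
  refine Set.image_congr fun s _ => ?_
  simp only [Complex.real_smul]
  ring

lemma curve_cons (α : ℝ) (b : Bool) (w : List Bool) :
    curve α (b :: w) = segment ℝ 0 Complex.I ∪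
      (fun z => Complex.I - rot (starRingEnd ℂ (halfTurn α) ^ 2) b * starRingEnd ℂ z) ''
        curve α w := by
  rw [curve, curve, List.length_cons, Finset.range_add_one', Finset.set_biUnion_insert,
    Finset.map_eq_image, Finset.set_biUnion_finset_image, Set.image_iUnion₂]
  congr 1
  · rw [zero_add, vertex_zero, ← zero_add 1, vertex_cons, vertex_zero]
    simp
  · simp only [image_segment_reflect, ← vertex_cons]
    rfl

/-- The curve of the empty word is empty whereas its `path` is {0}; inserting the origin makes the
induction uniform. -/
lemma insert_curve (hρ : ‖ρ‖ = 1) (w : List Bool) :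
    insert 0 (curve α w) = (fun z => Complex.I * starRingEnd ℂ ρ * z) ''
      path ρ (starRingEnd ℂ (halfTurn α) ^ 2) w := by
  have h := conj_mul_self_of_norm_eq_one hρ
  induction w with
  | nil => simp [curve, path]
  | cons b w ih =>
    rw [curve_cons, path, Set.image_union, image_segment_mul, mul_assoc, h, mul_one,
      Set.image_image]
    have h1 : (fun z => Complex.I * starRingEnd ℂ ρ *
        (ρ + ρ ^ 2 * rot (starRingEnd ℂ (halfTurn α) ^ 2) b * starRingEnd ℂ z)) ''
          path ρ (starRingEnd ℂ (halfTurn α) ^ 2) w =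
        (fun z => Complex.I - rot (starRingEnd ℂ (halfTurn α) ^ 2) b * starRingEnd ℂ z) ''
          insert 0 (curve α w) := by
      rw [ih, Set.image_image]
      refine Set.image_congr fun z _ => ?_
      simp only [map_mul, Complex.conj_I, Complex.conj_conj]
      linear_combination (Complex.I + Complex.I * ρ * rot (starRingEnd ℂ (halfTurn α) ^ 2) b *
        starRingEnd ℂ z) * h
    rw [h1, Set.image_insert_eq, map_zero, mul_zero, sub_zero, Set.union_insert,
      Set.insert_eq_of_mem (Set.mem_union_left _ (right_mem_segment ℝ 0 Complex.I)),
      Set.insert_eq_of_mem (Set.mem_union_left _ (left_mem_segment ℝ 0 Complex.I))]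

lemma curve_eq (hρ : ‖ρ‖ = 1) {w : List Bool} (hw : w ≠ []) :
    curve α w = (fun z => Complex.I * starRingEnd ℂ ρ * z) ''
      path ρ (starRingEnd ℂ (halfTurn α) ^ 2) w := by
  rw [← insert_curve hρ]
  obtain ⟨b, w, rfl⟩ := List.exists_cons_of_ne_nil hw
  rw [curve_cons]
  exact (Set.insert_eq_of_mem (Set.mem_union_left _ (left_mem_segment ℝ 0 Complex.I))).symm

end Curve

section Words

variable (i : ℕ)

lemma word_add_two {n : ℕ} (hn : 1 ≤ n) : word i (n + 2) = word i (n + 1) ++ word i n := by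
  obtain ⟨k, rfl⟩ : ∃ k, n = k + 1 := ⟨n - 1, by omega⟩
  rfl

lemma word_ne_nil {n : ℕ} (hn : 1 ≤ n) : word i n ≠ [] := by
  induction n using Nat.strong_induction_on with
  | _ n ih =>
    rcases n with _ | _ | _ | n
    · omega
    · simp [word]
    · simp [word]
    · rw [word_add_two i (by omega)]
      simp [ih (n + 1) (by omega) (by omega)]

/-- Two consecutive words commute up to the last two letters of their product. -/
lemma exists_word_append_comm {n : ℕ} (hn : 1 ≤ n) :
    ∃ p s s' : List Bool, s.length = 2 ∧ s'.length = 2 ∧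
      word i (n + 1) ++ word i n = p ++ s ∧ word i n ++ word i (n + 1) = p ++ s' := by
  induction n, hn using Nat.le_induction with
  | base =>
    refine ⟨List.replicate (i - 1) false, [true, false], [false, true], rfl, rfl, ?_, ?_⟩
    · simp [word]
    · change false :: List.replicate (i - 1) false ++ [true] = _
      rw [← List.replicate_succ, List.replicate_succ', List.append_assoc]
      rfl
  | succ n hn ih =>
    obtain ⟨p, s, s', hs, hs', h1, h2⟩ := ih
    -- Both products begin with f(n+1), followed by f(n) and f(n+1) in the two orders, so the
    -- endings exchange their roles.
    refine ⟨word i (n + 1) ++ p, s', s, hs', hs, ?_, ?_⟩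
    · rw [word_add_two i hn, List.append_assoc, h2, List.append_assoc]
    · rw [word_add_two i hn, h1, List.append_assoc]

/-- The grouping isolates four factors that are f(n+3) or its near-copy f(n+1) f(n+2), and a single
f(n). -/
lemma word_add_six {n : ℕ} (hn : 1 ≤ n) :
    word i (n + 6) = word i (n + 3) ++ word i (n + 3) ++ word i n ++
      (word i (n + 1) ++ word i (n + 2)) ++ (word i (n + 1) ++ word i (n + 2)) := by
  rw [word_add_two i (n := n + 4) (by omega), word_add_two i (n := n + 3) (by omega),
    word_add_two i (n := n + 2) (by omega), word_add_two i (n := n + 1) (by omega),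
    word_add_two i hn]
  simp only [List.append_assoc]

end Words

end FibonacciFractal

end

/-! ### Period three of the linear parts, and growth of the displacements. -/

noncomputable section

open Filter Topology

namespace FibonacciFractal

section Levels

/-- The linear part of a word, conjugated `k` times. -/
def linT (ρ τ : ℂ) (k : ℕ) (w : List Bool) : ℂ := cj k (lin ρ τ w)

/-- The displacement of a word, conjugated `k` times. -/
def dispT (ρ τ : ℂ) (k : ℕ) (w : List Bool) : ℂ := cj k (disp ρ τ w)

/-- The curve of a word, conjugated `k` times. -/
def pathT (ρ τ : ℂ) (k : ℕ) (w : List Bool) : Set ℂ := cj k '' path ρ τ w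

variable (ρ τ : ℂ) (k : ℕ)

lemma cj_comm (a b : ℕ) (z : ℂ) : cj a (cj b z) = cj b (cj a z) := by
  rw [← cj_add, add_comm, cj_add]

lemma linT_append (v w : List Bool) :
    linT ρ τ k (v ++ w) = linT ρ τ k v * cj v.length (linT ρ τ k w) := by
  rw [linT, lin_append, map_mul, cj_comm, linT, linT]

lemma dispT_append (v w : List Bool) :
    dispT ρ τ k (v ++ w) = dispT ρ τ k v + linT ρ τ k v * cj v.length (dispT ρ τ k w) := by
  rw [dispT, disp_append, map_add, map_mul, cj_comm, dispT, dispT, linT]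

lemma pathT_append (v w : List Bool) :
    pathT ρ τ k (v ++ w) = pathT ρ τ k v ∪
      (fun z => dispT ρ τ k v + linT ρ τ k v * cj v.length z) '' pathT ρ τ k w := by
  rw [pathT, path_append, Set.image_union, Set.image_image, pathT, pathT, Set.image_image]
  congr 1
  refine Set.image_congr fun z _ => ?_
  rw [map_add, map_mul, cj_comm, dispT, linT]

lemma linT_succ (w : List Bool) : linT ρ τ (k + 1) w = starRingEnd ℂ (linT ρ τ k w) :=
  cj_succ k _

lemma dispT_succ (w : List Bool) : dispT ρ τ (k + 1) w = starRingEnd ℂ (dispT ρ τ k w) :=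
  cj_succ k _

lemma pathT_succ (w : List Bool) : pathT ρ τ (k + 1) w = starRingEnd ℂ '' pathT ρ τ k w := by
  rw [pathT, pathT, Set.image_image]
  exact Set.image_congr fun z _ => cj_succ k z

lemma linT_eq_conj (w : List Bool) : linT ρ τ k w = starRingEnd ℂ (linT ρ τ (k + 1) w) := by
  rw [linT_succ, Complex.conj_conj]

lemma pathT_eq_conj (w : List Bool) :
    pathT ρ τ k w = starRingEnd ℂ '' pathT ρ τ (k + 1) w := by
  rw [pathT_succ, Set.image_image]
  simp

lemma iUnion_fin_five {β : Type*} (s : Fin 5 → Set β) :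
    ⋃ j, s j = s 0 ∪ s 1 ∪ s 2 ∪ s 3 ∪ s 4 := by
  ext z
  simp [Fin.exists_fin_succ, or_assoc]

lemma cj_congr {a b : ℕ} (h : Even a ↔ Even b) (z : ℂ) : cj a z = cj b z := by
  simp [cj, h]

/-- The hypotheses say that `e j` and the parity of `f j` are the linear part and the length parity
of everything before part `j`. -/
lemma pathT_append_five (x : Fin 5 → List Bool) (e : Fin 5 → ℂ) (f : Fin 5 → ℕ) (he : e 0 = 1)
    (hf : Even (f 0))
    (h : ∀ j : Fin 4, e j.succ = e j.castSucc * cj (f j.castSucc) (linT ρ τ k (x j.castSucc)) ∧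
      (Even (f j.succ) ↔ Even (f j.castSucc + (x j.castSucc).length))) :
    pathT ρ τ k (x 0 ++ x 1 ++ x 2 ++ x 3 ++ x 4) =
      ⋃ j, (fun z => partialSums (fun j => e j * cj (f j) (dispT ρ τ k (x j))) j +
        e j * cj (f j) z) '' pathT ρ τ k (x j) := by
  have step : ∀ (j : Fin 4) (v : List Bool), linT ρ τ k v = e j.castSucc →
      (∀ z, cj v.length z = cj (f j.castSucc) z) →
      linT ρ τ k (v ++ x j.castSucc) = e j.succ ∧
      ∀ z, cj (v ++ x j.castSucc).length z = cj (f j.succ) z := by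
    intro j v h1 h2
    refine ⟨by rw [linT_append, h1, h2, (h j).1], fun z => ?_⟩
    rw [List.length_append, cj_add, h2, ← cj_add]
    exact cj_congr (h j).2.symm z
  obtain ⟨l1, c1⟩ := step 0 [] (by simp [linT, lin, he]) (fun z => by
    rw [List.length_nil, cj_zero]; exact (cj_of_even hf z).symm)
  obtain ⟨l2, c2⟩ := step 1 _ l1 c1
  obtain ⟨l3, c3⟩ := step 2 _ l2 c2
  obtain ⟨l4, c4⟩ := step 3 _ l3 c3
  simp only [List.nil_append] at l1 c1 l2 c2 l3 c3 l4 c4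
  change linT ρ τ k (x 0) = e 1 at l1
  change linT ρ τ k (x 0 ++ x 1) = e 2 at l2
  change linT ρ τ k (x 0 ++ x 1 ++ x 2) = e 3 at l3
  change linT ρ τ k (x 0 ++ x 1 ++ x 2 ++ x 3) = e 4 at l4
  change ∀ z, cj (x 0).length z = cj (f 1) z at c1
  change ∀ z, cj (x 0 ++ x 1).length z = cj (f 2) z at c2
  change ∀ z, cj (x 0 ++ x 1 ++ x 2).length z = cj (f 3) z at c3
  change ∀ z, cj (x 0 ++ x 1 ++ x 2 ++ x 3).length z = cj (f 4) z at c4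
  rw [iUnion_fin_five, pathT_append, pathT_append, pathT_append, pathT_append]
  simp only [dispT_append, l1, l2, l3, l4, c1, c2, c3, c4, partialSums, he, cj_of_even hf,
    Matrix.cons_val, one_mul, zero_add, Set.image_id']

end Levels

/-- The initial frame `ρ` fits the words from index `m` on. -/
structure IsSeed (i m : ℕ) (ρ τ : ℂ) : Prop where
  one_le : 1 ≤ m
  norm_frame : ‖ρ‖ = 1
  norm_turn : ‖τ‖ = 1
  odd_length : Odd (word i m).length
  odd_length_succ : Odd (word i (m + 1)).length
  lin_eq : lin ρ τ (word i m) = τ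
  lin_succ_eq : lin ρ τ (word i (m + 1)) = 1

namespace IsSeed

variable {i m : ℕ} {ρ τ : ℂ} (h : IsSeed i m ρ τ)

include h

lemma conj_mul_self : starRingEnd ℂ τ * τ = 1 := conj_mul_self_of_norm_eq_one h.norm_turn

lemma word_two (k : ℕ) :
    word i (m + 3 * k + 2) = word i (m + 3 * k + 1) ++ word i (m + 3 * k) :=
  word_add_two i (by have := h.one_le; omega)

omit h in
lemma word_three (k : ℕ) :
    word i (m + 3 * (k + 1)) = word i (m + 3 * k + 2) ++ word i (m + 3 * k + 1) :=
  word_add_two i (n := m + 3 * k + 1) (by omega)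

omit h in
lemma word_four (k : ℕ) :
    word i (m + 3 * (k + 1) + 1) = word i (m + 3 * (k + 1)) ++ word i (m + 3 * k + 2) :=
  word_add_two i (n := m + 3 * k + 2) (by omega)

/-- The length parities odd, odd, even recur under addition. Linear parts τ, 1 produce conj τ for
the next two words and then 1, which is the initial pair conjugated; one extra conjugation per level
makes the pattern constant. -/
lemma levels (k : ℕ) : Odd (word i (m + 3 * k)).length ∧ Odd (word i (m + 3 * k + 1)).length ∧
    linT ρ τ k (word i (m + 3 * k)) = τ ∧ linT ρ τ k (word i (m + 3 * k + 1)) = 1 := by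
  induction k with
  | zero => exact ⟨h.odd_length, h.odd_length_succ, by simp [linT, h.lin_eq],
      by simp [linT, h.lin_succ_eq]⟩
  | succ k ih =>
    obtain ⟨h1, h2, h3, h4⟩ := ih
    have e2 : Even (word i (m + 3 * k + 2)).length := by
      rw [h.word_two, List.length_append]; exact h2.add_odd h1
    have e3 : Odd (word i (m + 3 * (k + 1))).length := by
      rw [word_three, List.length_append]; exact e2.add_odd h2
    have l2 : linT ρ τ k (word i (m + 3 * k + 2)) = starRingEnd ℂ τ := by
      rw [h.word_two, linT_append, h4, h3, cj_of_odd h2, one_mul]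
    have l3 : linT ρ τ k (word i (m + 3 * (k + 1))) = starRingEnd ℂ τ := by
      rw [word_three, linT_append, l2, h4, map_one, mul_one]
    refine ⟨e3, ?_, ?_, ?_⟩
    · rw [word_four, List.length_append]; exact e3.add_even e2
    · rw [linT_succ, l3, Complex.conj_conj]
    · rw [linT_succ, word_four, linT_append, l3, l2, cj_of_odd e3, Complex.conj_conj,
        h.conj_mul_self, map_one]

lemma even_length (k : ℕ) : Even (word i (m + 3 * k + 2)).length := by
  obtain ⟨h1, h2, -, -⟩ := h.levels k
  rw [h.word_two, List.length_append]; exact h2.add_odd h1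

lemma linT_two (k : ℕ) : linT ρ τ k (word i (m + 3 * k + 2)) = starRingEnd ℂ τ := by
  obtain ⟨-, h2, h3, h4⟩ := h.levels k
  rw [h.word_two, linT_append, h4, h3, cj_of_odd h2, one_mul]

lemma linT_three (k : ℕ) : linT ρ τ k (word i (m + 3 * (k + 1))) = starRingEnd ℂ τ := by
  rw [linT_eq_conj, (h.levels (k + 1)).2.2.1]

lemma dispT_two (k : ℕ) : dispT ρ τ k (word i (m + 3 * k + 2)) =
    dispT ρ τ k (word i (m + 3 * k + 1)) + starRingEnd ℂ (dispT ρ τ k (word i (m + 3 * k))) := by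
  obtain ⟨-, h2, -, h4⟩ := h.levels k
  rw [h.word_two, dispT_append, h4, cj_of_odd h2, one_mul]

lemma dispT_three (k : ℕ) : dispT ρ τ (k + 1) (word i (m + 3 * (k + 1))) =
    starRingEnd ℂ (dispT ρ τ k (word i (m + 3 * k + 2)) +
      starRingEnd ℂ τ * dispT ρ τ k (word i (m + 3 * k + 1))) := by
  rw [dispT_succ, word_three, dispT_append, h.linT_two, cj_of_even (h.even_length k)]

lemma dispT_four (k : ℕ) : dispT ρ τ (k + 1) (word i (m + 3 * (k + 1) + 1)) =
    starRingEnd ℂ (dispT ρ τ k (word i (m + 3 * k + 2)) +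
      starRingEnd ℂ τ * dispT ρ τ k (word i (m + 3 * k + 1)) +
      starRingEnd ℂ τ * starRingEnd ℂ (dispT ρ τ k (word i (m + 3 * k + 2)))) := by
  have h3 := h.dispT_three k
  rw [dispT_succ] at h3
  rw [dispT_succ, word_four, dispT_append, h.linT_three, cj_of_odd (h.levels (k + 1)).1,
    map_add, h3, ← map_add]

end IsSeed

section Growth

variable {α : ℝ}

/-- The two-dimensional linear recursion behind the displacements. -/
lemma exists_real_growth (hc : 0 ≤ Real.cos α) (hC : 0 < Real.cos (α / 2))
    (a b δ : ℕ → ℝ) (D : ℝ) (ha : 0 < a 0) (hb : 0 < b 0) (hδ0 : ∀ k, 0 ≤ δ k)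
    (hδ : ∀ k, δ k ≤ D)
    (hra : ∀ k, a (k + 1) = a k + 2 * Real.cos (α / 2) * b k)
    (hrb : ∀ k, b (k + 1) = (1 + 2 * Real.cos α) * b k + 2 * Real.cos (α / 2) * a k + δ k) :
    ∃ z M : ℝ, 0 < z ∧ ∀ k,
      |a k - z * (scalingRatio α)⁻¹ ^ k * (2 * Real.cos (α / 2) * scalingRatio α)| ≤ M ∧
      |b k - z * (scalingRatio α)⁻¹ ^ k * (1 - scalingRatio α)| ≤ M := by
  have hR := scalingRatio_pos hc
  have hR2 := scalingRatio_lt hc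
  have hrel := scalingRatio_sq hc
  have hCc : Real.cos α = 2 * Real.cos (α / 2) ^ 2 - 1 := by
    rw [← Real.cos_two_mul]; congr 1; ring
  generalize scalingRatio α = R at *
  generalize Real.cos (α / 2) = C at *
  generalize Real.cos α = c at *
  subst hCc
  have hD : 0 ≤ D := (hδ0 0).trans (hδ 0)
  have hR1 : R < 1 := by linarith
  -- Up to scale, `p` and `q` are the coordinates along the orthogonal eigenvectors (2CR, 1 - R) and
  -- (1 - R, -2CR) of the recursion, with eigenvalues 1/R and -R.
  set p : ℕ → ℝ := fun k => 2 * C * R * a k + (1 - R) * b k with hp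
  set q : ℕ → ℝ := fun k => (1 - R) * a k - 2 * C * R * b k with hq
  have hrp : ∀ k, R * p (k + 1) = p k + R * ((1 - R) * δ k) := fun k => by
    simp only [hp, hra, hrb]
    linear_combination b k * hrel
  have hrq : ∀ k, q (k + 1) = -R * q k - 2 * C * R * δ k := fun k => by
    simp only [hq, hra, hrb]
    linear_combination (-a k - 2 * C * b k) * hrel
  -- Normalized by its growth, `p` increases because the perturbation is nonnegative, and its
  -- increments are geometrically small. Hence it has a limit, which is positive because it starts
  -- positive.
  set y : ℕ → ℝ := fun k => p k * R ^ k with hy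
  have hstep : ∀ k, y (k + 1) = y k + R * (1 - R) * δ k * R ^ k := fun k => by
    simp only [hy, pow_succ]
    linear_combination R ^ k * hrp k
  have hinc : ∀ k, 0 ≤ R * (1 - R) * δ k * R ^ k := fun k =>
    mul_nonneg (mul_nonneg (mul_nonneg hR.le (by linarith)) (hδ0 k)) (by positivity)
  have hmono : Monotone y := monotone_nat_of_le_succ fun k => by
    rw [hstep]; linarith [hinc k]
  have hdist : ∀ k, dist (y k) (y (k + 1)) ≤ R * (1 - R) * D * R ^ k := fun k => by
    rw [hstep, dist_self_add_right, Real.norm_of_nonneg (hinc k)]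
    have := mul_nonneg hR.le (show 0 ≤ 1 - R by linarith)
    gcongr
    exact hδ k
  obtain ⟨L, hL⟩ := cauchySeq_tendsto_of_complete (cauchySeq_of_le_geometric R _ hR1 hdist)
  have hL0 : 0 < L := by
    have h0 : 0 < y 0 := by
      simp only [hy, hp, pow_zero, mul_one]
      have : 0 < 1 - R := by linarith
      positivity
    exact h0.trans_le (hmono.ge_of_tendsto hL 0)
  have hpL : ∀ k, |p k - L * R⁻¹ ^ k| ≤ D := fun k => by
    have h1 := dist_le_of_le_geometric_of_tendsto R _ hR1 hdist hL k
    rw [Real.dist_eq] at h1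
    have h2 : p k - L * R⁻¹ ^ k = (y k - L) * R⁻¹ ^ k := by
      simp only [hy, sub_mul, mul_assoc, ← mul_pow, mul_inv_cancel₀ hR.ne', one_pow, mul_one]
    have h3 : R * (1 - R) * D * R ^ k / (1 - R) = R * D * R ^ k := by
      field_simp [show 1 - R ≠ 0 by linarith]
    rw [h2, abs_mul, abs_of_pos (show 0 < R⁻¹ ^ k by positivity)]
    rw [h3] at h1
    calc |y k - L| * R⁻¹ ^ k ≤ R * D * R ^ k * R⁻¹ ^ k := by gcongr
      _ = R * D := by rw [mul_assoc, ← mul_pow, mul_inv_cancel₀ hR.ne', one_pow, mul_one]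
      _ ≤ D := by nlinarith
  -- The bound is preserved because 2R < 1.
  have hqb : ∀ k, |q k| ≤ |q 0| + 2 * C * D := fun k => by
    have hCD : 0 ≤ C * D := by positivity
    induction k with
    | zero => linarith
    | succ k ih =>
      have h1 : |q (k + 1)| ≤ R * |q k| + 2 * C * R * δ k := by
        rw [hrq]
        refine (abs_sub _ _).trans ?_
        rw [abs_mul, abs_neg, abs_of_pos hR,
          abs_of_nonneg (mul_nonneg (by positivity) (hδ0 k))]
      have h2 : 2 * C * R * δ k ≤ 2 * C * R * D := by gcongr; exact hδ k
      have h3 : R * |q k| ≤ R * (|q 0| + 2 * C * D) := by gcongr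
      nlinarith [abs_nonneg (q 0)]
  -- The squared length of either eigenvector, needed to recover `a` and `b` from `p` and `q`.
  set V : ℝ := (2 * C * R) ^ 2 + (1 - R) ^ 2 with hV
  have hV0 : 0 < V := by positivity
  set B := |q 0| + 2 * C * D with hB
  have hB0 : 0 ≤ B := by positivity
  have h1R : 0 ≤ 1 - R := by linarith
  refine ⟨L / V, (2 * C * R + (1 - R)) * (D + B) / V, by positivity, fun k => ⟨?_, ?_⟩⟩
  · have : a k - L / V * R⁻¹ ^ k * (2 * C * R) =
        (2 * C * R * (p k - L * R⁻¹ ^ k) + (1 - R) * q k) / V := by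
      rw [eq_div_iff hV0.ne', sub_mul, show L / V * R⁻¹ ^ k * (2 * C * R) * V =
        L * R⁻¹ ^ k * (2 * C * R) by field_simp]
      simp only [hp, hq, hV]
      ring
    rw [this, abs_div, abs_of_pos hV0]
    gcongr
    refine (abs_add_le _ _).trans ?_
    rw [abs_mul _ (p k - _), abs_mul _ (q k), abs_of_nonneg h1R,
      abs_of_pos (show 0 < 2 * C * R by positivity)]
    have h1 := mul_le_mul_of_nonneg_left (hpL k) (show 0 ≤ 2 * C * R by positivity)
    have h2 := mul_le_mul_of_nonneg_left (hqb k) h1R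
    have h3 : 0 ≤ 2 * C * R * B := by positivity
    nlinarith [mul_nonneg h1R hD]
  · have : b k - L / V * R⁻¹ ^ k * (1 - R) =
        ((1 - R) * (p k - L * R⁻¹ ^ k) - 2 * C * R * q k) / V := by
      rw [eq_div_iff hV0.ne', sub_mul, show L / V * R⁻¹ ^ k * (1 - R) * V =
        L * R⁻¹ ^ k * (1 - R) by field_simp]
      simp only [hp, hq, hV]
      ring
    rw [this, abs_div, abs_of_pos hV0]
    gcongr
    refine (abs_sub _ _).trans ?_
    rw [abs_mul _ (p k - _), abs_mul _ (q k), abs_of_nonneg h1R,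
      abs_of_pos (show 0 < 2 * C * R by positivity)]
    have h1 := mul_le_mul_of_nonneg_left (hpL k) h1R
    have h2 := mul_le_mul_of_nonneg_left (hqb k) (show 0 ≤ 2 * C * R by positivity)
    have h3 : 0 ≤ 2 * C * R * D := by positivity
    nlinarith [mul_nonneg h1R hB0]

/-- The displacements of two families of words which satisfy the recursion of the Fibonacci words
grow geometrically in fixed directions. -/
lemma exists_growth (hα : α ∈ Set.Icc (0 : ℝ) (Real.pi / 2)) (dA dB : ℕ → ℂ)
    (hA : ∀ k, dA (k + 1) = starRingEnd ℂ (dB k + starRingEnd ℂ (dA k) + halfTurn α ^ 2 * dB k))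
    (hB : ∀ k, dB (k + 1) = starRingEnd ℂ (dB k + starRingEnd ℂ (dA k) + halfTurn α ^ 2 * dB k +
      halfTurn α ^ 2 * starRingEnd ℂ (dB k + starRingEnd ℂ (dA k))))
    (ha : 0 < (dA 0).re) (hb : 0 < (halfTurn α * dB 0).re)
    (hp : Real.sin (α / 2) * (dA 0).im ≤ 0)
    (hr : Real.sin (α / 2) * (dA 0).im ≤
      2 * Real.sin (α / 2) * Real.cos (α / 2) * (halfTurn α * dB 0).im) :
    ∃ z M : ℝ, 0 < z ∧ ∀ k,
      ‖dB k + starRingEnd ℂ (dA k) - (z * (scalingRatio α)⁻¹ ^ k : ℝ) * evenEnd α‖ ≤ M ∧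
      ‖dB k - (z * (scalingRatio α)⁻¹ ^ k : ℝ) *
        ((1 - scalingRatio α : ℝ) * starRingEnd ℂ (halfTurn α))‖ ≤ M := by
  have hc := cos_nonneg_of_mem hα
  have hC := cos_half_pos hα
  have hcs := Real.sin_sq_add_cos_sq (α / 2)
  have hc2 : Real.cos α = 2 * Real.cos (α / 2) ^ 2 - 1 := by
    rw [← Real.cos_two_mul]; congr 1; ring
  have ure := halfTurn_re α
  have uim := halfTurn_im α
  set C := Real.cos (α / 2) with hCdef
  set S := Real.sin (α / 2) with hSdef
  -- Relative to the directions 1 and exp(-iα/2), the components `a`, `b` carry the growth; the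
  -- transverse components `p`, `r` will stay bounded.
  set a : ℕ → ℝ := fun k => (dA k).re with ha_def
  set p : ℕ → ℝ := fun k => (dA k).im with hp_def
  set b : ℕ → ℝ := fun k => (halfTurn α * dB k).re with hb_def
  set r : ℕ → ℝ := fun k => (halfTurn α * dB k).im with hr_def
  have huB : ∀ k, halfTurn α * dB (k + 1) =
      halfTurn α * (starRingEnd ℂ (dB k) + dA k) +
        starRingEnd ℂ (halfTurn α) * (starRingEnd ℂ (dB k) + dB k + starRingEnd ℂ (dA k)) :=
    fun k => by
    rw [hB]
    simp only [map_add, map_mul, map_pow, Complex.conj_conj]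
    linear_combination starRingEnd ℂ (halfTurn α) * (starRingEnd ℂ (dB k) + dB k +
      starRingEnd ℂ (dA k)) * halfTurn_mul_conj α
  have hra : ∀ k, a (k + 1) = a k + 2 * C * b k := fun k => by
    simp only [ha_def, hb_def, hA, pow_two, Complex.conj_re, Complex.add_re, Complex.mul_re,
      Complex.mul_im, ure, uim]
    linear_combination -(dB k).re * hcs
  have hrp : ∀ k, p (k + 1) = p k - 2 * C * r k := fun k => by
    simp only [hp_def, hr_def, hA, pow_two, Complex.conj_im, Complex.add_im,
      Complex.mul_re, Complex.mul_im, ure, uim]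
    linear_combination (dB k).im * hcs
  have hrb : ∀ k, b (k + 1) = (1 + 2 * Real.cos α) * b k + 2 * C * a k +
      (4 * S * C * r k - 2 * S * p k) := fun k => by
    simp only [ha_def, hb_def, hr_def, hp_def, hc2]
    rw [huB k]
    simp only [Complex.conj_re, Complex.conj_im,
      Complex.add_re, Complex.add_im, Complex.mul_re, Complex.mul_im, ure, uim]
    linear_combination -4 * C * (dB k).re * hcs
  have hrr : ∀ k, r (k + 1) = - r k := fun k => by
    simp only [hr_def]
    rw [huB k]
    simp only [Complex.conj_re, Complex.conj_im,
      Complex.add_re, Complex.add_im, Complex.mul_im, ure, uim]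
    ring
  -- The transverse map (p, r) ↦ (p - 2Cr, -r) is an involution, so only two states occur. In them
  -- the forcing term is 4SC r₀ - 2S p₀ or -2S p₀; the last two hypotheses are exactly its
  -- nonnegativity.
  have hstate : ∀ k, p k = p 0 ∧ r k = r 0 ∨ p k = p 0 - 2 * C * r 0 ∧ r k = - r 0 := fun k => by
    induction k with
    | zero => exact Or.inl ⟨rfl, rfl⟩
    | succ k ih =>
      rw [hrp, hrr]
      rcases ih with ⟨h1, h2⟩ | ⟨h1, h2⟩
      · exact Or.inr ⟨by rw [h1, h2], by rw [h2]⟩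
      · exact Or.inl ⟨by rw [h1, h2]; ring, by rw [h2]; ring⟩
  set N : ℝ := |p 0| + |p 0 - 2 * C * r 0| + |r 0| with hN
  have hpN : ∀ k, |p k| ≤ N := fun k => by
    have h1 := abs_nonneg (p 0)
    have h2 := abs_nonneg (p 0 - 2 * C * r 0)
    have h3 := abs_nonneg (r 0)
    rcases hstate k with ⟨h, -⟩ | ⟨h, -⟩ <;> rw [h] <;> linarith
  have hrN : ∀ k, |r k| ≤ N := fun k => by
    have h1 := abs_nonneg (p 0)
    have h2 := abs_nonneg (p 0 - 2 * C * r 0)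
    rcases hstate k with ⟨-, h⟩ | ⟨-, h⟩ <;> rw [h]
    · linarith
    · rw [abs_neg]; linarith
  obtain ⟨z, M, hz, hM⟩ := exists_real_growth hc hC a b (fun k => 4 * S * C * r k - 2 * S * p k)
    (|4 * S * C * r 0 - 2 * S * p 0| + |2 * S * p 0|) ha hb
    (fun k => by
      change S * p 0 ≤ 0 at hp
      change S * p 0 ≤ 2 * S * C * r 0 at hr
      rcases hstate k with ⟨h1, h2⟩ | ⟨h1, h2⟩ <;> simp only [h1, h2] <;> nlinarith)
    (fun k => by
      rcases hstate k with ⟨h1, h2⟩ | ⟨h1, h2⟩ <;> simp only [h1, h2]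
      · linarith [le_abs_self (4 * S * C * r 0 - 2 * S * p 0), abs_nonneg (2 * S * p 0)]
      · linarith [neg_le_abs (2 * S * p 0), abs_nonneg (4 * S * C * r 0 - 2 * S * p 0)])
    hra hrb
  have hBk : ∀ k, ‖dB k - (z * (scalingRatio α)⁻¹ ^ k : ℝ) *
      ((1 - scalingRatio α : ℝ) * starRingEnd ℂ (halfTurn α))‖ ≤ M + N := fun k => by
    have h1 : dB k - (z * (scalingRatio α)⁻¹ ^ k : ℝ) *
        ((1 - scalingRatio α : ℝ) * starRingEnd ℂ (halfTurn α)) = starRingEnd ℂ (halfTurn α) *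
        ((b k - z * (scalingRatio α)⁻¹ ^ k * (1 - scalingRatio α) : ℝ) + r k * Complex.I) := by
      have h2 : halfTurn α * dB k = b k + r k * Complex.I := (Complex.re_add_im _).symm
      push_cast
      linear_combination starRingEnd ℂ (halfTurn α) * h2 - dB k * halfTurn_mul_conj α
    rw [h1, norm_mul, RCLike.norm_conj, norm_halfTurn, one_mul]
    refine (norm_add_le _ _).trans (add_le_add ?_ ?_)
    · rw [Complex.norm_real]; exact (hM k).2
    · rw [norm_mul, Complex.norm_I, mul_one, Complex.norm_real]; exact hrN k
  refine ⟨z, M + N + (M + N), hz, fun k => ⟨?_, ?_⟩⟩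
  · have h1 : dB k + starRingEnd ℂ (dA k) - (z * (scalingRatio α)⁻¹ ^ k : ℝ) * evenEnd α =
        (dB k - (z * (scalingRatio α)⁻¹ ^ k : ℝ) *
          ((1 - scalingRatio α : ℝ) * starRingEnd ℂ (halfTurn α))) +
        ((a k - z * (scalingRatio α)⁻¹ ^ k * (2 * C * scalingRatio α) : ℝ) +
          (-p k : ℝ) * Complex.I) := by
      have h2 : starRingEnd ℂ (dA k) = a k - p k * Complex.I := by
        apply Complex.ext <;> simp [ha_def, hp_def]
      have h3 : halfTurn α + starRingEnd ℂ (halfTurn α) = 2 * C := by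
        rw [Complex.add_conj, ure]; push_cast; ring
      rw [h2, evenEnd]
      push_cast
      linear_combination -(z * (scalingRatio α : ℂ)⁻¹ ^ k) * scalingRatio α * h3
    rw [h1]
    refine (norm_add_le _ _).trans (add_le_add (hBk k) ((norm_add_le _ _).trans
      (add_le_add ?_ ?_)))
    · rw [Complex.norm_real]; exact (hM k).1
    · rw [norm_mul, Complex.norm_I, mul_one, Complex.norm_real, norm_neg]; exact hpN k
  · have := (norm_nonneg _).trans (hBk k)
    linarith [hBk k]

end Growth

end FibonacciFractal

end

/-! ### Hausdorff distance between the curves and the scaled attractors. -/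

noncomputable section

open Filter Topology

namespace FibonacciFractal

lemma partialSums_sub_mul (s : ℂ) (d d' : Fin 5 → ℂ) (j : Fin 5) :
    partialSums d j - s * partialSums d' j = partialSums (fun j => d j - s * d' j) j := by
  fin_cases j <;> simp [partialSums] <;> ring

lemma norm_partialSums_le {M : ℝ} (g : Fin 5 → ℂ) (hg : ∀ j, ‖g j‖ ≤ M) (j : Fin 5) :
    ‖partialSums g j‖ ≤ 4 * M := by
  have hM : 0 ≤ M := (norm_nonneg _).trans (hg 0)
  have h1 : ‖partialSums g 1‖ ≤ M := hg 0
  have h2 : ‖partialSums g 2‖ ≤ M + M := (norm_add_le _ _).trans (add_le_add h1 (hg 1))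
  have h3 : ‖partialSums g 3‖ ≤ M + M + M := (norm_add_le _ _).trans (add_le_add h2 (hg 2))
  have h4 : ‖partialSums g 4‖ ≤ M + M + M + M := (norm_add_le _ _).trans (add_le_add h3 (hg 3))
  have h0 : ‖partialSums g 0‖ ≤ 0 := by simp [partialSums]
  fin_cases j
  exacts [h0.trans (by linarith), h1.trans (by linarith), h2.trans (by linarith),
    h3.trans (by linarith), h4.trans (by linarith)]

lemma hausdorffEDist_image_le_of_dist_le {β : Type*} {f g : β → ℂ} {d : ℝ} (X : Set β)
    (h : ∀ x ∈ X, dist (f x) (g x) ≤ d) :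
    Metric.hausdorffEDist (f '' X) (g '' X) ≤ ENNReal.ofReal d := by
  refine Metric.hausdorffEDist_le_of_mem_edist ?_ ?_
  · rintro _ ⟨x, hx, rfl⟩
    exact ⟨g x, Set.mem_image_of_mem g hx, by
      rw [edist_dist]; exact ENNReal.ofReal_le_ofReal (h x hx)⟩
  · rintro _ ⟨x, hx, rfl⟩
    exact ⟨f x, Set.mem_image_of_mem f hx, by
      rw [edist_dist, dist_comm]; exact ENNReal.ofReal_le_ofReal (h x hx)⟩

lemma hausdorffEDist_mul_image_le {X Y : Set ℂ} {d : ℝ} (a : ℂ) (hd : 0 ≤ d)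
    (h : Metric.hausdorffEDist X Y ≤ ENNReal.ofReal d) :
    Metric.hausdorffEDist ((fun z => a * z) '' X) ((fun z => a * z) '' Y) ≤
      ENNReal.ofReal (‖a‖ * (d + 1)) := by
  -- Adding 1 gives a strict inequality, from which nearby points can be chosen; the loss is
  -- harmless after rescaling.
  have hlt : Metric.hausdorffEDist X Y < ENNReal.ofReal (d + 1) :=
    h.trans_lt ((ENNReal.ofReal_lt_ofReal_iff (by linarith)).2 (by linarith))
  have key : ∀ x y : ℂ, edist x y < ENNReal.ofReal (d + 1) →
      edist (a * x) (a * y) ≤ ENNReal.ofReal (‖a‖ * (d + 1)) := by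
    intro x y hxy
    rw [edist_dist, ENNReal.ofReal_lt_ofReal_iff (by linarith)] at hxy
    rw [edist_dist, dist_eq_norm, ← mul_sub, norm_mul, ← dist_eq_norm]
    exact ENNReal.ofReal_le_ofReal (mul_le_mul_of_nonneg_left hxy.le (norm_nonneg a))
  refine Metric.hausdorffEDist_le_of_mem_edist ?_ ?_
  · rintro _ ⟨x, hx, rfl⟩
    obtain ⟨y, hy, hxy⟩ := Metric.exists_edist_lt_of_hausdorffEDist_lt hx hlt
    exact ⟨a * y, Set.mem_image_of_mem _ hy, key x y hxy⟩
  · rintro _ ⟨y, hy, rfl⟩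
    rw [Metric.hausdorffEDist_comm] at hlt
    obtain ⟨x, hx, hxy⟩ := Metric.exists_edist_lt_of_hausdorffEDist_lt hy hlt
    exact ⟨a * x, Set.mem_image_of_mem _ hx, key y x hxy⟩

/-- The levels from which the five parts of a curve are taken. -/
def partLevel : Fin 5 → ℕ := ![1, 1, 0, 1, 1]

lemma ratio_mul_partRatio {α : ℝ} (hc : 0 ≤ Real.cos α) (k : ℕ) (j : Fin 5) :
    (scalingRatio α)⁻¹ ^ (k + 2) * partRatio α j = (scalingRatio α)⁻¹ ^ (k + partLevel j) := by
  have hR := (scalingRatio_pos hc).ne'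
  fin_cases j <;> simp only [partRatio, partLevel, Matrix.cons_val, Fin.zero_eta, Fin.mk_one,
    Fin.reduceFinMk, pow_add] <;> field_simp

/-- Curves which consist of five parts as the fractal does, up to bounded errors, stay within a
linearly growing distance of the scaled fractal. -/
lemma exists_hausdorffEDist_le {α : ℝ} (hc : 0 ≤ Real.cos α) (e : Fin 5 → ℂ)
    (he : ∀ j, ‖e j‖ = 1) (flip : Fin 5 → ℕ) (P : ℂ) (z M : ℝ) (K : ℕ → Set ℂ)
    (L : ℕ → Fin 5 → Set ℂ) (D : ℕ → Fin 5 → ℂ)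
    (hne : ∀ k, (K k).Nonempty) (hbd : ∀ k, Bornology.IsBounded (K k))
    (hK : ∀ k, K (k + 2) = ⋃ j, (fun w => partialSums (fun j => e j * cj (flip j) (D k j)) j +
      e j * cj (flip j) w) '' L k j)
    (hL : ∀ k j, Metric.hausdorffEDist (L k j) (K (k + partLevel j)) ≤ 4)
    (hD : ∀ k j, ‖D k j - (z * (scalingRatio α)⁻¹ ^ (k + partLevel j) : ℝ) * P‖ ≤ M) :
    ∃ c : ℝ, 0 ≤ c ∧ ∀ k, Metric.hausdorffEDist (K k)
      ((fun w => ((z * (scalingRatio α)⁻¹ ^ k : ℝ) : ℂ) * w) ''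
        (chainSystem hc e he flip P).attractor) ≤ ENNReal.ofReal (c * (k + 1)) := by
  set T := chainSystem hc e he flip P with hT
  set s : ℕ → ℝ := fun k => z * (scalingRatio α)⁻¹ ^ k with hs
  set δ : ℕ → ENNReal := fun k =>
    Metric.hausdorffEDist (K k) ((fun w => (s k : ℂ) * w) '' T.attractor) with hδ
  have hM : 0 ≤ M := (norm_nonneg _).trans (hD 0 0)
  have hδtop : ∀ k, δ k ≠ ⊤ := fun k => by
    refine Metric.hausdorffEDist_ne_top_of_nonempty_of_bounded (hne k)
      (T.attractor_nonempty.image _) (hbd k) ?_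
    exact (T.isCompact_attractor.image (continuous_const.mul continuous_id)).isBounded
  have hsplit : ∀ k j, (s (k + 2) : ℂ) * partRatio α j = s (k + partLevel j) := fun k j => by
    have := ratio_mul_partRatio hc k j
    simp only [hs]
    rw [← this]
    push_cast
    ring
  -- Both sets split into five parts with the same isometric linear parts. The error 4 comes from
  -- replacing a part by a curve of the sequence, and 4 * M from at most four preceding
  -- displacements.
  have hstep : ∀ k, δ (k + 2) ≤ max (δ (k + 1)) (δ k) + ENNReal.ofReal (4 + 4 * M) := by
    intro k
    have hG : (fun w => (s (k + 2) : ℂ) * w) '' T.attractor =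
        ⋃ j, (fun w => (s (k + 2) : ℂ) * partialSums (partEnd (partRatio α) e flip P) j +
          e j * cj (flip j) w) '' ((fun w => (s (k + partLevel j) : ℂ) * w) '' T.attractor) := by
      conv_lhs => rw [T.attractor_eq]
      rw [Set.image_iUnion]
      refine Set.iUnion_congr fun j => ?_
      rw [Set.image_image, Set.image_image]
      refine Set.image_congr fun w _ => ?_
      simp only [hT, chainSystem, affineSystem, map_mul, cj_ofReal, ← hsplit]
      ring
    simp only [hδ]
    rw [hK, hG]
    refine Metric.hausdorffEDist_iUnion_le.trans (iSup_le fun j => ?_)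
    refine (Metric.hausdorffEDist_triangle (t := (fun w =>
      partialSums (fun j => e j * cj (flip j) (D k j)) j + e j * cj (flip j) w) ''
        ((fun w => (s (k + partLevel j) : ℂ) * w) '' T.attractor))).trans ?_
    rw [Metric.hausdorffEDist_image (isometry_motion (he j) _ _)]
    have h1 : Metric.hausdorffEDist (L k j)
        ((fun w => (s (k + partLevel j) : ℂ) * w) '' T.attractor) ≤
        4 + max (δ (k + 1)) (δ k) := by
      refine (Metric.hausdorffEDist_triangle (t := K (k + partLevel j))).trans
        (add_le_add (hL k j) ?_)
      fin_cases j
      exacts [le_max_left _ _, le_max_left _ _, le_max_right _ _, le_max_left _ _, le_max_left _ _]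
    have h2 := hausdorffEDist_image_le_of_dist_le (d := 4 * M)
      (f := fun w => partialSums (fun j => e j * cj (flip j) (D k j)) j + e j * cj (flip j) w)
      (g := fun w => (s (k + 2) : ℂ) * partialSums (partEnd (partRatio α) e flip P) j +
        e j * cj (flip j) w) ((fun w => (s (k + partLevel j) : ℂ) * w) '' T.attractor)
      (fun w _ => by
        rw [dist_eq_norm, add_sub_add_right_eq_sub, partialSums_sub_mul]
        refine norm_partialSums_le _ (fun j => ?_) j
        have : e j * cj (flip j) (D k j) - s (k + 2) * partEnd (partRatio α) e flip P j =
            e j * cj (flip j) (D k j - s (k + partLevel j) * P) := by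
          rw [partEnd, map_sub, map_mul, cj_ofReal, ← hsplit]
          ring
        rw [this, norm_mul, he, one_mul, norm_cj]
        exact hD k j)
    refine (add_le_add h1 h2).trans_eq ?_
    rw [ENNReal.ofReal_add (by norm_num) (by positivity), add_comm (4 : ENNReal), add_assoc]
    norm_num
    rfl
  set c : ℝ := (δ 0).toReal + (δ 1).toReal + (4 + 4 * M) with hcdef
  have hc0 : 0 ≤ c := by positivity
  refine ⟨c, hc0, ?_⟩
  have hall : ∀ k, δ k ≤ ENNReal.ofReal (c * (k + 1)) ∧
      δ (k + 1) ≤ ENNReal.ofReal (c * ((k + 1 : ℕ) + 1)) := by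
    intro k
    induction k with
    | zero =>
      have h0 := ENNReal.toReal_nonneg (a := δ 0)
      have h1 := ENNReal.toReal_nonneg (a := δ 1)
      refine ⟨?_, ?_⟩
      · rw [← ENNReal.ofReal_toReal (hδtop 0)]
        refine ENNReal.ofReal_le_ofReal ?_
        push_cast
        linarith
      · rw [← ENNReal.ofReal_toReal (hδtop (0 + 1))]
        refine ENNReal.ofReal_le_ofReal ?_
        push_cast
        linarith
    | succ k ih =>
      refine ⟨ih.2, (hstep k).trans ?_⟩
      have h1 : max (δ (k + 1)) (δ k) ≤ ENNReal.ofReal (c * ((k + 1 : ℕ) + 1)) := by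
        refine max_le ih.2 (ih.1.trans (ENNReal.ofReal_le_ofReal ?_))
        push_cast
        nlinarith
      refine (add_le_add_left h1 _).trans ?_
      rw [← ENNReal.ofReal_add (by positivity) (by positivity)]
      refine ENNReal.ofReal_le_ofReal ?_
      have h0 := ENNReal.toReal_nonneg (a := δ 0)
      have h1 := ENNReal.toReal_nonneg (a := δ 1)
      push_cast
      linarith
  exact fun k => (hall k).1

lemma dimH_mul_image {a : ℂ} (ha : a ≠ 0) (X : Set ℂ) : dimH ((fun z => a * z) '' X) = dimH X := by
  have hlip : ∀ b : ℂ, LipschitzWith ‖b‖₊ fun z => b * z := fun b =>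
    LipschitzWith.of_dist_le_mul fun x y => by
      rw [dist_eq_norm, ← mul_sub, norm_mul, ← dist_eq_norm]; rfl
  refine le_antisymm ((hlip a).dimH_image_le X) ?_
  have h := (hlip a⁻¹).dimH_image_le ((fun z => a * z) '' X)
  rw [Set.image_image] at h
  simpa [inv_mul_cancel_left₀ ha] using h

/-- Curves within a linearly growing distance of exponentially growing copies of a compact set have
a scaling limit similar to that set. -/
lemma exists_isScalingLimit {i : ℕ} {α : ℝ} (hc : 0 ≤ Real.cos α) {ρ : ℂ} (hρ : ‖ρ‖ = 1)
    (n : ℕ → ℕ) (hn : ∀ k, 1 ≤ n k) {G : Set ℂ} (hG : IsCompact G) (hGne : G.Nonempty)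
    {Q : ℂ} (hQ : Q ≠ 0) {z M c : ℝ} (hz : 0 < z) (hc0 : 0 ≤ c)
    (hd : ∀ k, ‖disp ρ (starRingEnd ℂ (halfTurn α) ^ 2) (word i (n k)) -
      (z * (scalingRatio α)⁻¹ ^ (2 * k) : ℝ) * Q‖ ≤ M)
    (hK : ∀ k, Metric.hausdorffEDist (path ρ (starRingEnd ℂ (halfTurn α) ^ 2) (word i (n k)))
      ((fun w => ((z * (scalingRatio α)⁻¹ ^ (2 * k) : ℝ) : ℂ) * w) '' G) ≤
        ENNReal.ofReal (c * ((2 * k : ℕ) + 1))) :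
    ∃ F : Set ℂ, IsScalingLimit i α n F ∧ dimH F = dimH G := by
  have hR := scalingRatio_pos hc
  have hR2 := scalingRatio_lt hc
  set R := scalingRatio α with hRdef
  set τ := starRingEnd ℂ (halfTurn α) ^ 2 with hτ
  set ν := Complex.I * starRingEnd ℂ ρ with hν
  have hνn : ‖ν‖ = 1 := by simp [hν, hρ]
  have hQn : 0 < ‖Q‖ := norm_pos_iff.2 hQ
  set s : ℕ → ℝ := fun k => z * R⁻¹ ^ (2 * k) with hs
  have hs0 : ∀ k, 0 < s k := fun k => by positivity
  set w : ℕ → ℝ := fun k => ‖disp ρ τ (word i (n k))‖ with hw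
  have hws : ∀ k, |w k - s k * ‖Q‖| ≤ M := fun k => by
    have h1 := (abs_norm_sub_norm_le (disp ρ τ (word i (n k))) ((s k : ℂ) * Q)).trans (hd k)
    rwa [norm_mul, Complex.norm_of_nonneg (hs0 k).le] at h1
  have hsinv : Tendsto (fun k => (s k)⁻¹) atTop (𝓝 0) := by
    have h1 : Tendsto (fun k : ℕ => z⁻¹ * (R ^ 2) ^ k) atTop (𝓝 0) := by
      simpa using (tendsto_pow_atTop_nhds_zero_of_lt_one (sq_nonneg R)
        (by nlinarith : R ^ 2 < 1)).const_mul z⁻¹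
    refine h1.congr fun k => ?_
    simp only [hs, mul_inv, inv_pow, inv_inv, pow_mul]
  have hlin : Tendsto (fun k : ℕ => (c * ((2 * k : ℕ) + 1) + 1) * (s k)⁻¹) atTop (𝓝 0) := by
    have h1 : Tendsto (fun k : ℕ => 2 * c * z⁻¹ * (k * (R ^ 2) ^ k) + (c + 1) * (s k)⁻¹) atTop
        (𝓝 (2 * c * z⁻¹ * 0 + (c + 1) * 0)) :=
      ((tendsto_self_mul_const_pow_of_lt_one (sq_nonneg R)
        (by nlinarith : R ^ 2 < 1)).const_mul _).add (hsinv.const_mul _)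
    rw [mul_zero, mul_zero, add_zero] at h1
    refine h1.congr fun k => ?_
    simp only [hs, mul_inv, inv_pow, inv_inv, pow_mul]
    push_cast
    ring
  -- The widths are asymptotic to s k * ‖Q‖, so normalizing by the width amounts to normalizing by
  -- the growth factor.
  have hratio : Tendsto (fun k => w k * (s k)⁻¹) atTop (𝓝 ‖Q‖) := by
    rw [tendsto_iff_dist_tendsto_zero]
    refine squeeze_zero (fun k => dist_nonneg) (fun k => ?_)
      (by simpa using hsinv.const_mul M : Tendsto (fun k => M * (s k)⁻¹) atTop (𝓝 0))
    have : w k * (s k)⁻¹ - ‖Q‖ = (w k - s k * ‖Q‖) * (s k)⁻¹ := by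
      have := (hs0 k).ne'
      field_simp
    rw [Real.dist_eq, this, abs_mul, abs_of_pos (inv_pos.2 (hs0 k))]
    exact mul_le_mul_of_nonneg_right (hws k) (inv_pos.2 (hs0 k)).le
  have hratio' : Tendsto (fun k => s k * (w k)⁻¹) atTop (𝓝 ‖Q‖⁻¹) := by
    refine (hratio.inv₀ hQn.ne').congr fun k => ?_
    rw [mul_inv, inv_inv, mul_comm]
  set b : ℂ := (Real.sqrt 2 * ‖Q‖⁻¹ : ℝ) * ν with hb
  have hb0 : b ≠ 0 := by
    rw [← norm_ne_zero_iff, hb, norm_mul, hνn, mul_one, Complex.norm_real]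
    exact norm_ne_zero_iff.2 (mul_ne_zero (by positivity) (inv_ne_zero hQn.ne'))
  obtain ⟨B, hB⟩ := hG.isBounded.exists_norm_le
  have hB0 : 0 ≤ B := by
    obtain ⟨x, hx⟩ := hGne
    exact (norm_nonneg x).trans (hB x hx)
  refine ⟨(fun z => b * z) '' G, ⟨hGne.image _, hG.image (continuous_const.mul continuous_id), ?_⟩,
    dimH_mul_image hb0 G⟩
  -- The first term is the linearly growing distance after rescaling; the second compares the
  -- normalizing factor with its limit.
  have hbound : ∀ k, Metric.hausdorffEDist (scaledCurve i α (n k)) ((fun z => b * z) '' G) ≤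
      ENNReal.ofReal (Real.sqrt 2 * (s k * (w k)⁻¹) * ((c * ((2 * k : ℕ) + 1) + 1) * (s k)⁻¹)) +
      ENNReal.ofReal (Real.sqrt 2 * |s k * (w k)⁻¹ - ‖Q‖⁻¹| * B) := by
    intro k
    set a : ℂ := (Real.sqrt 2 * (w k)⁻¹ : ℝ) * ν with ha
    have han : ‖a‖ = Real.sqrt 2 * (w k)⁻¹ := by
      rw [ha, norm_mul, hνn, mul_one, Complex.norm_of_nonneg (by positivity)]
    have hcurve : scaledCurve i α (n k) = (fun z => a * z) '' path ρ τ (word i (n k)) := by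
      rw [scaledCurve, curve_eq hρ (word_ne_nil i (hn k)), Set.image_image, width_eq hρ]
      refine Set.image_congr fun x _ => ?_
      simp only [Complex.real_smul, ha, hν, hw, div_eq_mul_inv, mul_assoc, hτ]
    rw [hcurve]
    refine (Metric.hausdorffEDist_triangle
      (t := (fun z => a * z) '' ((fun w => (s k : ℂ) * w) '' G))).trans (add_le_add ?_ ?_)
    · refine (hausdorffEDist_mul_image_le a (by positivity) (hK k)).trans_eq ?_
      congr 1
      rw [han]
      have := (hs0 k).ne'
      field_simp
    · rw [Set.image_image]
      refine hausdorffEDist_image_le_of_dist_le G fun x hx => ?_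
      have : a * (s k * x) - b * x = ((Real.sqrt 2 * (s k * (w k)⁻¹ - ‖Q‖⁻¹) : ℝ) : ℂ) * ν * x := by
        rw [ha, hb]
        push_cast
        ring
      rw [dist_eq_norm, this, norm_mul, norm_mul, hνn, mul_one, Complex.norm_real, norm_mul,
        Real.norm_eq_abs, Real.norm_eq_abs, abs_of_nonneg (Real.sqrt_nonneg 2)]
      gcongr
      exact hB x hx
  refine tendsto_of_tendsto_of_tendsto_of_le_of_le tendsto_const_nhds ?_ (fun k => zero_le) hbound
  have h1 : Tendsto (fun k : ℕ => Real.sqrt 2 * (s k * (w k)⁻¹) *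
      ((c * ((2 * k : ℕ) + 1) + 1) * (s k)⁻¹)) atTop (𝓝 0) := by
    simpa using (hratio'.const_mul (Real.sqrt 2)).mul hlin
  have h2 : Tendsto (fun k => Real.sqrt 2 * |s k * (w k)⁻¹ - ‖Q‖⁻¹| * B) atTop (𝓝 0) := by
    have := ((hratio'.sub_const ‖Q‖⁻¹).abs.const_mul (Real.sqrt 2)).mul_const B
    simpa using this
  simpa using (ENNReal.tendsto_ofReal h1).add (ENNReal.tendsto_ofReal h2)

end FibonacciFractal

end

/-! ### From the decomposition of the words to the scaling limits. -/

noncomputable section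

open Filter Topology

namespace FibonacciFractal

lemma pathT_eq_cj (ρ τ : ℂ) (k l : ℕ) (w : List Bool) :
    pathT ρ τ k w = cj l '' pathT ρ τ (k + l) w := by
  rw [pathT, pathT, Set.image_image]
  refine Set.image_congr fun z _ => ?_
  rw [add_comm, cj_add, cj_cj]

lemma dispT_eq_cj (ρ τ : ℂ) (k l : ℕ) (w : List Bool) :
    dispT ρ τ k w = cj l (dispT ρ τ (k + l) w) := by
  rw [dispT, dispT, add_comm, cj_add, cj_cj]

/-- The five consecutive parts of the word with index `n + 6`. -/
def parts (i n : ℕ) : Fin 5 → List Bool :=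
  ![word i (n + 3), word i (n + 3), word i n, word i (n + 1) ++ word i (n + 2),
    word i (n + 1) ++ word i (n + 2)]

/-- Each part is viewed at its own level, so that it is comparable with a curve of the sequence; the
extra conjugation is absorbed by `flip`. -/
lemma pathT_add_six (ρ τ : ℂ) (k i n : ℕ) (hn : 1 ≤ n) (e : Fin 5 → ℂ) (flip : Fin 5 → ℕ)
    (he : e 0 = 1) (hf : Even (flip 0 + partLevel 0))
    (h : ∀ j : Fin 4, e j.succ = e j.castSucc * cj (flip j.castSucc + partLevel j.castSucc)
        (linT ρ τ k (parts i n j.castSucc)) ∧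
      (Even (flip j.succ + partLevel j.succ) ↔
        Even (flip j.castSucc + partLevel j.castSucc + (parts i n j.castSucc).length))) :
    pathT ρ τ k (word i (n + 6)) = ⋃ j, (fun z => partialSums (fun j => e j * cj (flip j)
      (dispT ρ τ (k + partLevel j) (parts i n j))) j + e j * cj (flip j) z) ''
        pathT ρ τ (k + partLevel j) (parts i n j) := by
  have h1 := pathT_append_five ρ τ k (parts i n) e (fun j => flip j + partLevel j) he hf h
  have h2 : parts i n 0 ++ parts i n 1 ++ parts i n 2 ++ parts i n 3 ++ parts i n 4 =
      word i (n + 6) := (word_add_six i hn).symm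
  rw [h2] at h1
  rw [h1]
  refine Set.iUnion_congr fun j => ?_
  have hcj : ∀ j z, cj (flip j + partLevel j) (cj (partLevel j) z) = cj (flip j) z :=
    fun j z => by rw [cj_add, cj_cj]
  have hfun : (fun j => e j * cj (flip j + partLevel j) (dispT ρ τ k (parts i n j))) =
      fun j => e j * cj (flip j) (dispT ρ τ (k + partLevel j) (parts i n j)) := by
    funext j
    rw [dispT_eq_cj ρ τ k (partLevel j), hcj]
  simp only [hfun, pathT_eq_cj ρ τ k (partLevel j), Set.image_image, hcj]

namespace IsSeed

variable {i m : ℕ} {ρ τ : ℂ}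

/-- The curves of the words of one of the two types converge to the fractal of that type. -/
lemma exists_isScalingLimit {α : ℝ} (hc : 0 ≤ Real.cos α)
    (h : IsSeed i m ρ (starRingEnd ℂ (halfTurn α) ^ 2)) (t : ℕ)
    (e : Fin 5 → ℂ) (he1 : ∀ j, ‖e j‖ = 1) (flip : Fin 5 → ℕ) {P : ℂ} (hP : P ≠ 0) {z M : ℝ}
    (hz : 0 < z) (he : e 0 = 1) (hf : Even (flip 0 + partLevel 0))
    (hchain : ∀ k, ∀ j : Fin 4,
      e j.succ = e j.castSucc * cj (flip j.castSucc + partLevel j.castSucc)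
        (linT ρ (starRingEnd ℂ (halfTurn α) ^ 2) k (parts i (m + 3 * k + t) j.castSucc)) ∧
      (Even (flip j.succ + partLevel j.succ) ↔
        Even (flip j.castSucc + partLevel j.castSucc +
          (parts i (m + 3 * k + t) j.castSucc).length)))
    (hd : ∀ k, ‖dispT ρ (starRingEnd ℂ (halfTurn α) ^ 2) k (word i (m + 3 * k + t)) -
      (z * (scalingRatio α)⁻¹ ^ k : ℝ) * P‖ ≤ M) :
    ∃ F : Set ℂ, IsScalingLimit i α (fun k => m + 3 * (2 * k) + t) F ∧
      dimH F = dimH (chainSystem hc e he1 flip P).attractor := by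
  have hm := h.one_le
  have hρ := h.norm_frame
  have hτ := h.norm_turn
  set τ := starRingEnd ℂ (halfTurn α) ^ 2
  have hnorm : ∀ w : List Bool, ∀ x ∈ path ρ τ w, ‖x‖ ≤ w.length := norm_le_of_mem_path hρ hτ
  have hword : ∀ k, word i (m + 3 * k + t + 3) = word i (m + 3 * (k + 1) + t) := fun k => by
    congr 1; ring
  -- The last two parts are f(n+1) f(n+2) instead of f(n+3); changing two letters costs at most 4 in
  -- position and in displacement.
  have hswap : ∀ k, Metric.hausdorffEDist
      (pathT ρ τ (k + 1) (word i (m + 3 * k + t + 1) ++ word i (m + 3 * k + t + 2)))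
      (pathT ρ τ (k + 1) (word i (m + 3 * (k + 1) + t))) ≤ 4 ∧
      ‖dispT ρ τ (k + 1) (word i (m + 3 * k + t + 1) ++ word i (m + 3 * k + t + 2)) -
      dispT ρ τ (k + 1) (word i (m + 3 * (k + 1) + t))‖ ≤ 4 := fun k => by
    obtain ⟨p, s, s', hs, hs', h1, h2⟩ :=
      exists_word_append_comm i (n := m + 3 * k + t + 1) (by omega)
    have h3 : word i (m + 3 * (k + 1) + t) = p ++ s := by
      rw [← hword, ← h1]
      exact word_add_two i (by omega)
    rw [h3, h2]
    refine ⟨?_, ?_⟩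
    · rw [pathT, pathT, Metric.hausdorffEDist_image (isometry_cj _)]
      exact hausdorffEDist_path_append_le hρ hτ p s' s hs' hs
    · rw [dispT, dispT, ← map_sub, norm_cj]
      exact norm_disp_append_sub_le hρ hτ p s' s hs' hs
  obtain ⟨c, hc0, hK⟩ := exists_hausdorffEDist_le hc e he1 flip P z (M + 4)
    (fun k => pathT ρ τ k (word i (m + 3 * k + t)))
    (fun k j => pathT ρ τ (k + partLevel j) (parts i (m + 3 * k + t) j))
    (fun k j => dispT ρ τ (k + partLevel j) (parts i (m + 3 * k + t) j))
    (fun k => ⟨_, Set.mem_image_of_mem _ (zero_mem_path ρ τ _)⟩)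
    (fun k => by
      refine isBounded_iff_forall_norm_le.2 ⟨(word i (m + 3 * k + t)).length, ?_⟩
      rintro _ ⟨x, hx, rfl⟩
      rw [norm_cj]
      exact hnorm _ x hx)
    (fun k => by
      have hw : m + 3 * (k + 2) + t = m + 3 * k + t + 6 := by ring
      simp only [hw]
      rw [← pathT_add_six ρ τ k i (m + 3 * k + t) (by omega) e flip he hf (hchain k),
        pathT_eq_conj ρ τ k, pathT_eq_conj ρ τ (k + 1), Set.image_image]
      simp)
    (fun k j => by
      have h0 : ∀ X : Set ℂ, Metric.hausdorffEDist X X ≤ 4 := fun X => by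
        rw [Metric.hausdorffEDist_self]; exact zero_le
      have h1 : Metric.hausdorffEDist (pathT ρ τ (k + 1) (word i (m + 3 * k + t + 3)))
          (pathT ρ τ (k + 1) (word i (m + 3 * (k + 1) + t))) ≤ 4 := by
        rw [hword]; exact h0 _
      fin_cases j
      exacts [h1, h1, h0 _, (hswap k).1, (hswap k).1])
    (fun k j => by
      have h1 : ‖dispT ρ τ (k + 1) (word i (m + 3 * k + t + 3)) -
          (z * (scalingRatio α)⁻¹ ^ (k + 1) : ℝ) * P‖ ≤ M + 4 := by
        rw [hword]; exact (hd (k + 1)).trans (by linarith)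
      have h2 : ‖dispT ρ τ (k + 1) (word i (m + 3 * k + t + 1) ++ word i (m + 3 * k + t + 2)) -
          (z * (scalingRatio α)⁻¹ ^ (k + 1) : ℝ) * P‖ ≤ M + 4 := by
        have := norm_add_le_of_le (hswap k).2 (hd (k + 1))
        rw [sub_add_sub_cancel] at this
        linarith
      fin_cases j
      exacts [h1, h1, (hd k).trans (by linarith), h2, h2])
  -- Only even levels are kept, where the conjugations cancel; this is why the indices advance by
  -- six.
  refine FibonacciFractal.exists_isScalingLimit hc hρ (fun k => m + 3 * (2 * k) + t)
    (fun k => by omega) (SimilaritySystem.isCompact_attractor _)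
    (SimilaritySystem.attractor_nonempty _) hP hz hc0 (M := M) (fun k => ?_) (fun k => ?_)
  · have := hd (2 * k)
    rwa [dispT, cj_of_even (even_two_mul k)] at this
  · have := hK (2 * k)
    rw [pathT] at this
    convert this using 2
    ext x
    simp only [cj_of_even (even_two_mul k), Set.image_id']
    rfl

lemma exists_isScalingLimit_even {α : ℝ} (hα : α ∈ Set.Icc (0 : ℝ) (Real.pi / 2))
    (h : IsSeed i m ρ (starRingEnd ℂ (halfTurn α) ^ 2)) {z M : ℝ} (hz : 0 < z)
    (hd : ∀ k, ‖dispT ρ (starRingEnd ℂ (halfTurn α) ^ 2) k (word i (m + 3 * k + 2)) -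
      (z * (scalingRatio α)⁻¹ ^ k : ℝ) * evenEnd α‖ ≤ M) :
    ∃ F : Set ℂ, IsScalingLimit i α (fun k => m + 3 * (2 * k) + 2) F ∧
      dimH F = ENNReal.ofReal (dimValue α) := by
  have hc := cos_nonneg_of_mem hα
  have hP : evenEnd α ≠ 0 := by
    intro h0
    have h1 := congrArg Complex.re h0
    simp only [evenEnd, Complex.add_re, Complex.conj_re, Complex.re_ofReal_mul, halfTurn_re,
      Complex.zero_re] at h1
    nlinarith [cos_half_pos hα, scalingRatio_pos hc, mul_pos (scalingRatio_pos hc) (cos_half_pos hα)]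
  have hτ : starRingEnd ℂ (halfTurn α) ^ 2 * halfTurn α ^ 2 = 1 := by
    rw [← mul_pow, mul_comm, halfTurn_mul_conj, one_pow]
  have hchain : ∀ k, ∀ j : Fin 4, evenRot α j.succ = evenRot α j.castSucc *
      cj (evenFlip j.castSucc + partLevel j.castSucc) (linT ρ (starRingEnd ℂ (halfTurn α) ^ 2) k
        (parts i (m + 3 * k + 2) j.castSucc)) ∧
      (Even (evenFlip j.succ + partLevel j.succ) ↔
        Even (evenFlip j.castSucc + partLevel j.castSucc +
          (parts i (m + 3 * k + 2) j.castSucc).length)) := by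
    intro k j
    obtain ⟨o1, o2, -, l2⟩ := h.levels (k + 1)
    have lX := h.linT_two (k + 1)
    have lA := h.linT_three k
    have lW := h.linT_two k
    rw [linT_succ, ← map_one (starRingEnd ℂ), (starRingEnd ℂ).injective.eq_iff] at l2
    rw [linT_succ, (starRingEnd ℂ).injective.eq_iff] at lX
    have eX : Even (word i (m + 3 * k + 2 + 3)).length := h.even_length (k + 1)
    have eW := h.even_length k
    have lY : linT ρ (starRingEnd ℂ (halfTurn α) ^ 2) k
        (word i (m + 3 * k + 2 + 1) ++ word i (m + 3 * k + 2 + 2)) = halfTurn α ^ 2 := by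
      change linT ρ _ k (word i (m + 3 * (k + 1)) ++ word i (m + 3 * (k + 1) + 1)) = _
      rw [linT_append, lA, l2, map_one, mul_one, map_pow, Complex.conj_conj]
    have eY : Even (word i (m + 3 * k + 2 + 1) ++ word i (m + 3 * k + 2 + 2)).length := by
      rw [List.length_append]
      exact Odd.add_odd o1 o2
    rw [map_pow, Complex.conj_conj] at lW
    have key : ∀ {a b : ℂ} {f g : ℕ} {w : List Bool} {l : ℂ}, Even f → Even g → Even w.length →
        linT ρ (starRingEnd ℂ (halfTurn α) ^ 2) k w = l → b = a * l →
        b = a * cj f (linT ρ (starRingEnd ℂ (halfTurn α) ^ 2) k w) ∧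
          (Even g ↔ Even (f + w.length)) := by
      rintro a b f g w l hf hg hw rfl hb
      exact ⟨by rw [cj_of_even hf, hb], iff_of_true hg (hf.add hw)⟩
    -- The linear parts multiply successively by τ, τ, conj τ, conj τ and return to 1.
    fin_cases j
    · exact key (by decide) (by decide) eX lX (one_mul _).symm
    · exact key (by decide) (by decide) eX lX (pow_add _ 2 2)
    · exact key (by decide) (by decide) eW lW
        (show starRingEnd ℂ (halfTurn α) ^ 2 = starRingEnd ℂ (halfTurn α) ^ 4 * _ by
          linear_combination -starRingEnd ℂ (halfTurn α) ^ 2 * hτ)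
    · exact key (by decide) (by decide) eY lY hτ.symm
  obtain ⟨F, hF, hdim⟩ := h.exists_isScalingLimit hc 2 (evenRot α) (norm_evenRot α) evenFlip hP hz
    rfl (by decide) hchain hd
  exact ⟨F, hF, hdim.trans (dimH_evenFractal hα hc)⟩

lemma exists_isScalingLimit_odd {α : ℝ} (hα : α ∈ Set.Icc (0 : ℝ) (Real.pi / 2))
    (h : IsSeed i m ρ (starRingEnd ℂ (halfTurn α) ^ 2)) {z M : ℝ} (hz : 0 < z)
    (hd : ∀ k, ‖dispT ρ (starRingEnd ℂ (halfTurn α) ^ 2) k (word i (m + 3 * k + 1)) -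
      (z * (scalingRatio α)⁻¹ ^ k : ℝ) * starRingEnd ℂ (halfTurn α)‖ ≤ M) :
    ∃ F : Set ℂ, IsScalingLimit i α (fun k => m + 3 * (2 * k) + 1) F ∧
      dimH F = ENNReal.ofReal (dimValue α) := by
  have hc := cos_nonneg_of_mem hα
  have hP : starRingEnd ℂ (halfTurn α) ≠ 0 := by
    rw [← norm_ne_zero_iff, RCLike.norm_conj, norm_halfTurn]
    exact one_ne_zero
  have hchain : ∀ k, ∀ j : Fin 4, oddRot α j.succ = oddRot α j.castSucc *
      cj (oddFlip j.castSucc + partLevel j.castSucc) (linT ρ (starRingEnd ℂ (halfTurn α) ^ 2) k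
        (parts i (m + 3 * k + 1) j.castSucc)) ∧
      (Even (oddFlip j.succ + partLevel j.succ) ↔
        Even (oddFlip j.castSucc + partLevel j.castSucc +
          (parts i (m + 3 * k + 1) j.castSucc).length)) := by
    intro k j
    obtain ⟨-, oW, -, lW⟩ := h.levels k
    obtain ⟨o1, oX, -, lX⟩ := h.levels (k + 1)
    have lA := h.linT_three k
    have lN := h.linT_two k
    have eN := h.even_length k
    rw [linT_succ, ← map_one (starRingEnd ℂ), (starRingEnd ℂ).injective.eq_iff] at lX
    have lY : linT ρ (starRingEnd ℂ (halfTurn α) ^ 2) k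
        (word i (m + 3 * k + 1 + 1) ++ word i (m + 3 * k + 1 + 2)) = halfTurn α ^ 4 := by
      change linT ρ _ k (word i (m + 3 * k + 2) ++ word i (m + 3 * (k + 1))) = _
      rw [linT_append, lA, lN, cj_of_even eN, map_pow, Complex.conj_conj, ← pow_add]
    have oY : Odd (word i (m + 3 * k + 1 + 1) ++ word i (m + 3 * k + 1 + 2)).length := by
      rw [List.length_append]
      exact Even.add_odd eN o1
    have key : ∀ {a b : ℂ} {f g : ℕ} {w : List Bool} {l : ℂ}, (Even g ↔ ¬ Even f) → Odd w.length →
        linT ρ (starRingEnd ℂ (halfTurn α) ^ 2) k w = l → b = a * cj f l →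
        b = a * cj f (linT ρ (starRingEnd ℂ (halfTurn α) ^ 2) k w) ∧
          (Even g ↔ Even (f + w.length)) := by
      rintro a b f g w l hf hw rfl hb
      refine ⟨hb, hf.trans ?_⟩
      rw [Nat.even_add, iff_false_right (Nat.not_even_iff_odd.2 hw)]
    have hone : ∀ f, (1 : ℂ) = 1 * cj f 1 := fun f => by rw [map_one, one_mul]
    -- The first three parts have linear part 1 at level k or one that is τ-free, so only the last
    -- near-copy, with linear part conj τ ², contributes a rotation.
    fin_cases j
    · exact key (by decide) oX lX (hone _)
    · exact key (by decide) oX lX (hone _)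
    · exact key (by decide) oW lW (hone _)
    · refine key (by decide) oY lY ?_
      change starRingEnd ℂ (halfTurn α) ^ 4 = 1 * cj 1 (halfTurn α ^ 4)
      rw [cj_one, map_pow, one_mul]
  obtain ⟨F, hF, hdim⟩ := h.exists_isScalingLimit hc 1 (oddRot α) (norm_oddRot α) oddFlip hP hz
    rfl (by decide) hchain hd
  exact ⟨F, hF, hdim.trans (dimH_oddFractal hα hc)⟩

/-- Both scaling limits, once the displacements of the first words are known to point forward. -/
lemma exists_scalingLimits {α : ℝ} (hα : α ∈ Set.Icc (0 : ℝ) (Real.pi / 2))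
    (h : IsSeed i m ρ (starRingEnd ℂ (halfTurn α) ^ 2)) {a b : ℂ}
    (hA : disp ρ (starRingEnd ℂ (halfTurn α) ^ 2) (word i m) = a)
    (hB : halfTurn α * disp ρ (starRingEnd ℂ (halfTurn α) ^ 2) (word i (m + 1)) = b)
    (ha : 0 < a.re) (hb : 0 < b.re) (hp : Real.sin (α / 2) * a.im ≤ 0)
    (hr : Real.sin (α / 2) * a.im ≤ 2 * Real.sin (α / 2) * Real.cos (α / 2) * b.im) :
    (∃ F : Set ℂ, IsScalingLimit i α (fun k => m + 3 * (2 * k) + 2) F ∧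
      dimH F = ENNReal.ofReal (dimValue α)) ∧
    (∃ F : Set ℂ, IsScalingLimit i α (fun k => m + 3 * (2 * k) + 1) F ∧
      dimH F = ENNReal.ofReal (dimValue α)) := by
  have hτ : starRingEnd ℂ (starRingEnd ℂ (halfTurn α) ^ 2) = halfTurn α ^ 2 := by
    rw [map_pow, Complex.conj_conj]
  have hR := scalingRatio_lt (cos_nonneg_of_mem hα)
  have hR0 := scalingRatio_pos (cos_nonneg_of_mem hα)
  obtain ⟨z, M, hz, hM⟩ := exists_growth hα
    (fun k => dispT ρ (starRingEnd ℂ (halfTurn α) ^ 2) k (word i (m + 3 * k)))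
    (fun k => dispT ρ (starRingEnd ℂ (halfTurn α) ^ 2) k (word i (m + 3 * k + 1)))
    (fun k => by rw [h.dispT_three, h.dispT_two, hτ])
    (fun k => by rw [h.dispT_four, h.dispT_two, hτ])
    (by simpa [dispT, hA] using ha) (by simpa [dispT, hB] using hb)
    (by simpa [dispT, hA] using hp) (by simpa [dispT, hA, hB] using hr)
  refine ⟨h.exists_isScalingLimit_even hα (M := M) hz fun k => ?_,
    h.exists_isScalingLimit_odd hα (z := z * (1 - scalingRatio α)) (M := M)
      (mul_pos hz (by linarith)) fun k => ?_⟩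
  · rw [h.dispT_two]
    exact (hM k).1
  · convert (hM k).2 using 3
    push_cast
    ring

end IsSeed

end FibonacciFractal

end

/-! ### Initial frames for odd and even `i`. -/

noncomputable section

namespace FibonacciFractal

section Seeds

variable {ρ τ : ℂ}

/-- Two consecutive zeros turn in opposite senses, so together they act by a pure translation. -/
lemma lin_replicate_append (hρ : ‖ρ‖ = 1) (hτ : ‖τ‖ = 1) (n : ℕ) (w : List Bool) :
    lin ρ τ (List.replicate (2 * n) false ++ w) = lin ρ τ w := by
  have h1 := conj_mul_self_of_norm_eq_one hρ
  have h2 := conj_mul_self_of_norm_eq_one hτ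
  induction n with
  | zero => rfl
  | succ n ih =>
    change lin ρ τ (false :: false :: (List.replicate (2 * n) false ++ w)) = _
    simp only [lin, ih, rot, map_mul, map_pow, Complex.conj_conj, Bool.false_eq_true, if_false]
    have h3 : (ρ * starRingEnd ℂ ρ) ^ 2 * (τ * starRingEnd ℂ τ) = 1 := by
      rw [mul_comm ρ, mul_comm τ, h1, h2]; ring
    linear_combination lin ρ τ w * h3

lemma disp_replicate_append (hρ : ‖ρ‖ = 1) (hτ : ‖τ‖ = 1) (n : ℕ) (w : List Bool) :
    disp ρ τ (List.replicate (2 * n) false ++ w) = n * (ρ * (1 + τ)) + disp ρ τ w := by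
  have h1 := conj_mul_self_of_norm_eq_one hρ
  have h2 := conj_mul_self_of_norm_eq_one hτ
  induction n with
  | zero => simp
  | succ n ih =>
    change disp ρ τ (false :: false :: (List.replicate (2 * n) false ++ w)) = _
    simp only [disp, ih, rot, map_mul, map_add, map_pow, map_one, map_natCast, Complex.conj_conj,
      Bool.false_eq_true, if_false]
    have h3 : (ρ * starRingEnd ℂ ρ) ^ 2 * (τ * starRingEnd ℂ τ) = 1 := by
      rw [mul_comm ρ, mul_comm τ, h1, h2]; ring
    push_cast
    linear_combination ρ * τ * h1 + (n * (ρ * (1 + τ)) + disp ρ τ w) * h3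

end Seeds

variable {α : ℝ}

lemma norm_conj_halfTurn_sq (α : ℝ) : ‖starRingEnd ℂ (halfTurn α) ^ 2‖ = 1 := by
  rw [norm_pow, RCLike.norm_conj, norm_halfTurn, one_pow]

lemma halfTurn_add_conj (α : ℝ) :
    halfTurn α + starRingEnd ℂ (halfTurn α) = (2 * Real.cos (α / 2) : ℝ) := by
  rw [Complex.add_conj, halfTurn_re]

lemma exists_scalingLimits_of_odd (hα : α ∈ Set.Icc (0 : ℝ) (Real.pi / 2)) {i n : ℕ}
    (hi : i = 2 * n + 1) :
    (∃ F : Set ℂ, IsScalingLimit i α (fun k => 1 + 3 * (2 * k) + 2) F ∧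
      dimH F = ENNReal.ofReal (dimValue α)) ∧
    (∃ F : Set ℂ, IsScalingLimit i α (fun k => 1 + 3 * (2 * k) + 1) F ∧
      dimH F = ENNReal.ofReal (dimValue α)) := by
  have hτ := norm_conj_halfTurn_sq α
  have hu := halfTurn_mul_conj α
  have hC := cos_half_pos hα
  have h2 : word i (1 + 1) = List.replicate (2 * n) false ++ [true] := by
    subst hi; rfl
  -- For odd `i` both f(1) and f(2) have odd length, and the trivial frame already gives the linear
  -- parts τ and 1.
  have h : IsSeed i 1 1 (starRingEnd ℂ (halfTurn α) ^ 2) := by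
    refine ⟨le_rfl, norm_one, hτ, odd_one, ?_, ?_, ?_⟩
    · rw [h2]
      simp
    · simp [word, lin, rot]
    · rw [h2, lin_replicate_append norm_one hτ]
      simp [lin, rot]
  refine h.exists_scalingLimits hα (a := 1)
    (b := n * ((2 * Real.cos (α / 2) : ℝ) : ℂ) + halfTurn α) ?_ ?_ ?_ ?_ ?_ ?_
  · simp [word, disp]
  · rw [h2, disp_replicate_append norm_one hτ, ← halfTurn_add_conj]
    simp only [disp, map_zero, mul_zero, add_zero]
    linear_combination n * starRingEnd ℂ (halfTurn α) * hu
  · simp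
  · rw [← Complex.ofReal_natCast, ← Complex.ofReal_mul, Complex.add_re, Complex.ofReal_re,
      halfTurn_re]
    positivity
  · simp
  · rw [← Complex.ofReal_natCast, ← Complex.ofReal_mul, Complex.add_im, Complex.ofReal_im,
      halfTurn_im, Complex.one_im]
    nlinarith [mul_nonneg hC.le (sq_nonneg (Real.sin (α / 2)))]

lemma exists_scalingLimits_of_even (hα : α ∈ Set.Icc (0 : ℝ) (Real.pi / 2)) {i n : ℕ}
    (hi : i = 2 * n + 2) :
    (∃ F : Set ℂ, IsScalingLimit i α (fun k => 3 + 3 * (2 * k) + 2) F ∧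
      dimH F = ENNReal.ofReal (dimValue α)) ∧
    (∃ F : Set ℂ, IsScalingLimit i α (fun k => 3 + 3 * (2 * k) + 1) F ∧
      dimH F = ENNReal.ofReal (dimValue α)) := by
  have hτ := norm_conj_halfTurn_sq α
  have hρ := norm_halfTurn α
  have hu := halfTurn_mul_conj α
  have hC := cos_half_pos hα
  set u := halfTurn α with hudef
  have hu2 : u ^ 2 * starRingEnd ℂ u ^ 2 = 1 := by rw [← mul_pow, hu, one_pow]
  have h2 : word i 2 = List.replicate (2 * n) false ++ [false, true] := by
    subst hi
    change List.replicate (2 * n + 1) false ++ [true] = _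
    rw [List.replicate_succ', List.append_assoc]
    rfl
  have h3 : word i 3 = List.replicate (2 * n) false ++ [false, true, false] := by
    change word i 2 ++ [false] = _
    rw [h2, List.append_assoc]
    rfl
  have h4 : word i (3 + 1) = word i 3 ++ word i 2 := rfl
  have o2 : Even (word i 2).length := by
    rw [h2]; simp [Nat.even_add]
  have o3 : Odd (word i 3).length := by
    rw [h3]; exact ⟨n + 1, by simp; ring⟩
  have l2 : lin u (starRingEnd ℂ u ^ 2) (word i 2) = starRingEnd ℂ u ^ 2 := by
    rw [h2, lin_replicate_append hρ hτ]
    simp [lin, rot, hu2]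
  have l3 : lin u (starRingEnd ℂ u ^ 2) (word i 3) = starRingEnd ℂ u ^ 2 := by
    rw [h3, lin_replicate_append hρ hτ]
    simp [lin, rot, hu2]
  have d2 : disp u (starRingEnd ℂ u ^ 2) (word i 2) = (n + 1) * (u + starRingEnd ℂ u) := by
    rw [h2, disp_replicate_append hρ hτ]
    simp only [disp, rot, map_zero, mul_zero, add_zero, Bool.false_eq_true, if_false, hu2]
    linear_combination n * starRingEnd ℂ u * hu
  have d3 : disp u (starRingEnd ℂ u ^ 2) (word i 3) =
      (n + 1) * (u + starRingEnd ℂ u) + starRingEnd ℂ u := by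
    rw [h3, disp_replicate_append hρ hτ]
    simp only [disp, rot, map_zero, mul_zero, add_zero, Bool.false_eq_true, if_false, hu2,
      if_true, map_add, map_mul, map_pow, map_one, Complex.conj_conj]
    linear_combination (n + 1) * starRingEnd ℂ u * hu
  have hsum : u + starRingEnd ℂ u = (2 * Real.cos (α / 2) : ℝ) := halfTurn_add_conj α
  -- For even `i` the word f(2) has even length, so the first consecutive pair of odd lengths is
  -- f(3), f(4). The frame u makes the linear factor u² τ of the letter 0 equal to 1.
  have h : IsSeed i 3 u (starRingEnd ℂ u ^ 2) := by
    refine ⟨by norm_num, hρ, hτ, o3, ?_, l3, ?_⟩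
    · rw [h4, List.length_append]
      exact o3.add_even o2
    · rw [h4, lin_append, l3, l2, cj_of_odd o3, map_pow, Complex.conj_conj, mul_comm, hu2]
  refine h.exists_scalingLimits hα
    (a := (((n + 1) * (2 * Real.cos (α / 2)) : ℝ) : ℂ) + starRingEnd ℂ u)
    (b := (((n + 1) * (2 * Real.cos (α / 2)) ^ 2 + 1 : ℝ) : ℂ)) ?_ ?_ ?_ ?_ ?_ ?_
  · rw [d3, hsum]
    push_cast
    ring
  · rw [h4, disp_append, d3, d2, l3, cj_of_odd o3]
    simp only [map_add, map_mul, map_natCast, map_one, Complex.conj_conj]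
    rw [← hudef, Complex.ofReal_add, Complex.ofReal_mul, Complex.ofReal_pow, ← hsum]
    push_cast
    linear_combination (1 + (n + 1) * starRingEnd ℂ u * (u + starRingEnd ℂ u)) * hu
  · rw [Complex.add_re, Complex.ofReal_re, Complex.conj_re, halfTurn_re]
    positivity
  · rw [Complex.ofReal_re]
    positivity
  · rw [Complex.add_im, Complex.ofReal_im, Complex.conj_im, halfTurn_im]
    nlinarith [sq_nonneg (Real.sin (α / 2))]
  · rw [Complex.add_im, Complex.ofReal_im, Complex.ofReal_im, Complex.conj_im, halfTurn_im]
    nlinarith [sq_nonneg (Real.sin (α / 2))]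

end FibonacciFractal

end

theorem proposition5p8 (i : ℕ) (hi : 2 ≤ i) (α : ℝ) (hα : α ∈ Set.Icc (0 : ℝ) (Real.pi / 2)) :
    (∃ F : Set ℂ, FibonacciFractal.IsScalingLimit i α (FibonacciFractal.index i) F ∧
      dimH F = ENNReal.ofReal (FibonacciFractal.dimValue α)) ∧
    (∃ F : Set ℂ,
      FibonacciFractal.IsScalingLimit i α (fun k => FibonacciFractal.index i k - 1) F ∧
      dimH F = ENNReal.ofReal (FibonacciFractal.dimValue α)) := by
  rcases Nat.even_or_odd i with he | ho
  · have h1 : FibonacciFractal.index i = fun k => 3 + 3 * (2 * k) + 2 := by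
      funext k
      rw [FibonacciFractal.index, if_pos he]
      omega
    have h2 : (fun k => FibonacciFractal.index i k - 1) = fun k => 3 + 3 * (2 * k) + 1 := by
      rw [h1]
      rfl
    obtain ⟨n, hn⟩ := he
    rw [h2, h1]
    -- Here i = n + n with n ≥ 1, so the truncated subtraction is exact and i = 2(n - 1) + 2.
    exact FibonacciFractal.exists_scalingLimits_of_even hα (n := n - 1) (by omega)
  · have h1 : FibonacciFractal.index i = fun k => 1 + 3 * (2 * k) + 2 := by
      funext k
      rw [FibonacciFractal.index, if_neg (Nat.not_even_iff_odd.2 ho)]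
      omega
    have h2 : (fun k => FibonacciFractal.index i k - 1) = fun k => 1 + 3 * (2 * k) + 1 := by
      rw [h1]
      rfl
    obtain ⟨n, hn⟩ := ho
    rw [h2, h1]
    exact FibonacciFractal.exists_scalingLimits_of_odd hα hn
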